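/- Let $\omega$ be a free ultrafilter on $\mathbb{N}$ and let $(n_k)_k$ be a sequence of positive integers with $\lim_k n_k=\infty$. On $M_m(\mathbb{C})$ write $Tr(A)=\frac1m\sum_i a_{ii}$ and $\|A\|_2=\sqrt{Tr(A^*A)}$. Let $$M=\Pi_{k\to\omega}M_{n_k}=\ell^\infty(\mathbb{N},M_{n_k})/\{(x_k)_k:\lim_{k\to\omega}\|x_k\|_2=0\},$$ where $\ell^\infty(\mathbb{N},M_{n_k})$ is the algebra of sequences $x_k\in M_{n_k}(\mathbb{C})$ that are bounded in operator norm, and equip $M$ with the trace $Tr(\Pi_{k\to\omega}x_k)=\lim_{k\to\omega}Tr(x_k)$ and the norm $\|x\|_2=\sqrt{Tr(x^*x)}$. For a unitary $u\in M$ let $A(u)$ be the von Neumann subalgebra of $M$ generated by $u$, i.e. the smallest unital $*$-subalgebra of $M$ that contains $u$ and is closed for $\|\cdot\|_2$. An associated measure of $u$ is a Borel measure $\mu$ on $S^1=\{z\in\mathbb{C}:|z|=1\}$, concentrated on the spectrum $\sigma(u)$, for which there is a $*$-isomorphism $A(u)\to L^\infty(\mu)$ that takes $u$ to the function $z\mapsto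 z$ and the trace $Tr$ to $\int\cdot\,d\mu$. Then every unitary $u\in M$ has exactly one associated measure $\mu_u$; it satisfies $\int_{S^1}z^m\,d\mu_u=Tr(u^m)$ for all $m\in\mathbb{Z}$. Two unitaries $u,v\in M$ are conjugated, i.e. $v=wuw^*$ for some unitary $w\in M$, if and only if $\mu_u=\mu_v$. -/

import Mathlib

open Filter Topology MeasureTheory
open scoped ENNReal Matrix.Norms.L2Operator

noncomputable section

namespace MatrixUltraproduct

/-- The algebra `M_m(ℂ)` for `m ≥ 1`. Its norm, from the scope `Matrix.Norms.L2Operator`, is the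
operator norm with respect to the Euclidean norm of `ℂ^m`; its star is the conjugate transpose. -/
abbrev Mat (m : ℕ+) : Type := Matrix (Fin m) (Fin m) ℂ

/-- The normalized trace `Tr A = (1/m) ∑ i, A i i`. -/
def ntr {m : ℕ+} (A : Mat m) : ℂ := ((m : ℕ) : ℂ)⁻¹ * A.trace

/-- The trace norm `‖A‖₂ = √((1/m) ∑ i j, |A i j|²)`. -/
def norm2 {m : ℕ+} (A : Mat m) : ℝ := √(((m : ℕ) : ℝ)⁻¹ * ∑ i, ∑ j, ‖A i j‖ ^ 2)

/-- `l^∞(ℕ, M_{n_k})`: sequences `x k ∈ M_{n_k}` that are bounded in operator norm, with the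
pointwise `*`-algebra operations. -/
abbrev BddSeq (n : ℕ → ℕ+) : Type := lp (fun k => Mat (n k)) ∞

theorem norm2_nonneg {m : ℕ+} (A : Mat m) : 0 ≤ norm2 A := Real.sqrt_nonneg _

theorem norm2_eq {m : ℕ+} (A : Mat m) :
    norm2 A = √(((m : ℕ) : ℝ)⁻¹) *
      ‖(WithLp.toLp 2 (fun p : Fin m × Fin m => A p.1 p.2) : EuclideanSpace ℂ (Fin m × Fin m))‖ := by
  rw [norm2, EuclideanSpace.norm_eq, ← Real.sqrt_mul (by positivity), Fintype.sum_prod_type]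

theorem norm2_zero {m : ℕ+} : norm2 (0 : Mat m) = 0 := by simp [norm2]

theorem norm2_neg {m : ℕ+} (A : Mat m) : norm2 (-A) = norm2 A := by simp [norm2]

theorem norm2_add_le {m : ℕ+} (A B : Mat m) : norm2 (A + B) ≤ norm2 A + norm2 B := by
  rw [norm2_eq, norm2_eq, norm2_eq, ← mul_add]
  refine mul_le_mul_of_nonneg_left ?_ (Real.sqrt_nonneg _)
  have h := norm_add_le
    (WithLp.toLp 2 (fun p : Fin m × Fin m => A p.1 p.2) : EuclideanSpace ℂ (Fin m × Fin m))
    (WithLp.toLp 2 (fun p : Fin m × Fin m => B p.1 p.2))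
  rw [← WithLp.toLp_add] at h
  exact h

theorem norm2_star {m : ℕ+} (A : Mat m) : norm2 (star A) = norm2 A := by
  unfold norm2
  rw [Finset.sum_comm]
  simp [Matrix.star_apply]

theorem norm2_mul_le_left {m : ℕ+} (A B : Mat m) : norm2 (A * B) ≤ ‖A‖ * norm2 B := by
  have key : ∀ j, ∑ i, ‖(A * B) i j‖ ^ 2 ≤ ‖A‖ ^ 2 * ∑ i, ‖B i j‖ ^ 2 := by
    intro j
    have h := Matrix.l2_opNorm_mulVec A (WithLp.toLp 2 (fun i => B i j))
    have h2 := pow_le_pow_left₀ (norm_nonneg _) h 2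
    rw [mul_pow, EuclideanSpace.norm_sq_eq, EuclideanSpace.norm_sq_eq] at h2
    exact h2
  have tot : ∑ i, ∑ j, ‖(A * B) i j‖ ^ 2 ≤ ‖A‖ ^ 2 * ∑ i, ∑ j, ‖B i j‖ ^ 2 := by
    rw [Finset.sum_comm, Finset.sum_comm (f := fun i j => ‖B i j‖ ^ 2), Finset.mul_sum]
    exact Finset.sum_le_sum fun j _ => key j
  unfold norm2
  apply Real.sqrt_le_iff.2 ⟨by positivity, ?_⟩
  rw [mul_pow, Real.sq_sqrt (by positivity)]
  calc ((m : ℕ) : ℝ)⁻¹ * ∑ i, ∑ j, ‖(A * B) i j‖ ^ 2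
      ≤ ((m : ℕ) : ℝ)⁻¹ * (‖A‖ ^ 2 * ∑ i, ∑ j, ‖B i j‖ ^ 2) := by gcongr
    _ = _ := by ring

theorem norm2_mul_le_right {m : ℕ+} (A B : Mat m) : norm2 (A * B) ≤ norm2 A * ‖B‖ := by
  have h := norm2_mul_le_left (star B) (star A)
  rwa [← star_mul, norm2_star, norm2_star, norm_star, mul_comm] at h

theorem norm_ntr_le {m : ℕ+} (A : Mat m) : ‖ntr A‖ ≤ norm2 A := by
  have hm : (0 : ℝ) < ((m : ℕ) : ℝ) := by exact_mod_cast m.pos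
  have h1 : ‖A.trace‖ ≤ ∑ i, ‖A i i‖ := norm_sum_le _ _
  have h2 : (∑ i, ‖A i i‖) ^ 2 ≤ ((m : ℕ) : ℝ) * ∑ i, ‖A i i‖ ^ 2 := by
    simpa using sq_sum_le_card_mul_sum_sq (s := Finset.univ) (f := fun i => ‖A i i‖)
  have h3 : ∑ i, ‖A i i‖ ^ 2 ≤ ∑ i, ∑ j, ‖A i j‖ ^ 2 :=
    Finset.sum_le_sum fun i _ =>
      Finset.single_le_sum (f := fun j => ‖A i j‖ ^ 2) (fun _ _ => by positivity)
        (Finset.mem_univ i)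
  apply Real.le_sqrt_of_sq_le
  have h4 : ‖A.trace‖ ^ 2 ≤ ((m : ℕ) : ℝ) * ∑ i, ∑ j, ‖A i j‖ ^ 2 :=
    (pow_le_pow_left₀ (norm_nonneg _) h1 2).trans (h2.trans (by gcongr))
  rw [ntr, norm_mul, mul_pow, norm_inv, Complex.norm_natCast]
  calc (((m : ℕ) : ℝ)⁻¹) ^ 2 * ‖A.trace‖ ^ 2
      ≤ (((m : ℕ) : ℝ)⁻¹) ^ 2 * (((m : ℕ) : ℝ) * ∑ i, ∑ j, ‖A i j‖ ^ 2) := by gcongr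
    _ = _ := by field_simp

/-- `x ~ y` iff `x - y ∈ 𝒩_ω`, that is `lim_{k→ω} ‖x_k - y_k‖₂ = 0`. -/
def nullCon (n : ℕ → ℕ+) (ω : Ultrafilter ℕ) : RingCon (BddSeq n) where
  r x y := Tendsto (fun k => norm2 (x k - y k)) ω (𝓝 0)
  iseqv :=
    { refl := fun x => by simp [norm2_zero]
      symm := fun {x y} h => by
        have : ∀ k, norm2 (y k - x k) = norm2 (x k - y k) := fun k => by
          rw [← norm2_neg, neg_sub]
        simpa only [this] using h
      trans := fun {x y z} h h' => by
        refine squeeze_zero (fun _ => norm2_nonneg _) (fun k => ?_) (by simpa using h.add h')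
        rw [← sub_add_sub_cancel (x k) (y k) (z k)]
        exact norm2_add_le _ _ }
  add' := fun {a b c d} h h' => by
    refine squeeze_zero (fun _ => norm2_nonneg _) (fun k => ?_) (by simpa using h.add h')
    have : (a + c) k - (b + d) k = (a k - b k) + (c k - d k) := add_sub_add_comm _ _ _ _
    rw [this]
    exact norm2_add_le _ _
  mul' := fun {a b c d} h h' => by
    refine squeeze_zero (fun _ => norm2_nonneg _) (fun k => ?_)
      (by simpa using (h'.const_mul ‖a‖).add (h.mul_const ‖d‖))
    have : (a * c) k - (b * d) k = a k * (c k - d k) + (a k - b k) * d k := by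
      change a k * c k - b k * d k = _
      noncomm_ring
    rw [this]
    refine (norm2_add_le _ _).trans (add_le_add ?_ ?_)
    · exact (norm2_mul_le_left _ _).trans (mul_le_mul_of_nonneg_right
        (lp.norm_apply_le_norm ENNReal.top_ne_zero a k) (norm2_nonneg _))
    · exact (norm2_mul_le_right _ _).trans (mul_le_mul_of_nonneg_left
        (lp.norm_apply_le_norm ENNReal.top_ne_zero d k) (norm2_nonneg _))

/-- The ultraproduct `Π_{k→ω} M_{n_k} = l^∞(ℕ, M_{n_k}) / 𝒩_ω`, a complex unital algebra. -/
def UProd (n : ℕ → ℕ+) (ω : Ultrafilter ℕ) : Type := (nullCon n ω).Quotient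

variable {n : ℕ → ℕ+} {ω : Ultrafilter ℕ}

instance : Ring (UProd n ω) := inferInstanceAs (Ring (nullCon n ω).Quotient)

instance : Algebra ℂ (UProd n ω) := inferInstanceAs (Algebra ℂ (nullCon n ω).Quotient)

/-- `Π_{k→ω} x_k`, the element of the ultraproduct represented by the bounded sequence `x`. -/
def UProd.mk (x : BddSeq n) : UProd n ω := RingCon.toQuotient (c := nullCon n ω) x

theorem nullCon_star {x y : BddSeq n} (h : nullCon n ω x y) : nullCon n ω (star x) (star y) := by
  change Tendsto (fun k => norm2 (star (x k) - star (y k))) ω (𝓝 0)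
  simp only [← star_sub, norm2_star]
  exact h

/-- The involution of the ultraproduct: `(Π x_k)^* = Π x_k^*`. -/
instance : StarRing (UProd n ω) where
  star := Quotient.map' star fun _ _ h => nullCon_star h
  star_involutive := by
    rintro ⟨x⟩
    exact congrArg (UProd.mk (ω := ω)) (star_star x)
  star_mul := by
    rintro ⟨x⟩ ⟨y⟩
    exact congrArg (UProd.mk (ω := ω)) (star_mul x y)
  star_add := by
    rintro ⟨x⟩ ⟨y⟩
    exact congrArg (UProd.mk (ω := ω)) (star_add x y)

instance : StarModule ℂ (UProd n ω) where
  star_smul := by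
    rintro c ⟨x⟩
    exact congrArg (UProd.mk (ω := ω)) (star_smul c x)

/-- The trace of the ultraproduct: `Tr (Π x_k) = lim_{k→ω} Tr (x_k)`. The limit exists, as
`|Tr (x_k)| ≤ ‖x_k‖` is bounded. -/
def Tr : UProd n ω → ℂ :=
  Quotient.lift (s := (nullCon n ω).toSetoid)
    (fun x : BddSeq n => limUnder (ω : Filter ℕ) fun k => ntr (x k)) <| by
    intro x y h
    have h0 : Tendsto (fun k => ntr (x k) - ntr (y k)) ω (𝓝 0) := by
      refine squeeze_zero_norm (fun k => ?_) (show Tendsto _ _ _ from h)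
      have : ntr (x k) - ntr (y k) = ntr (x k - y k) := by
        simp [ntr, mul_sub]
      rw [this]
      exact norm_ntr_le _
    have h1 : ∀ l : ℂ, Tendsto (fun k => ntr (x k)) ω (𝓝 l) ↔
        Tendsto (fun k => ntr (y k)) ω (𝓝 l) := fun l =>
      ⟨fun hx => by simpa using hx.sub h0, fun hy => by simpa using hy.add h0⟩
    change Classical.epsilon _ = Classical.epsilon _
    congr 1
    funext l
    exact propext (h1 l)

/-- The trace norm of the ultraproduct, `‖x‖₂ = √(Tr (x^* x))`. -/
def unorm2 (x : UProd n ω) : ℝ := √((Tr (star x * x)).re)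

/-- A von Neumann subalgebra of the tracial von Neumann algebra `(Π_{k→ω} M_{n_k}, Tr)`: a unital
`*`-subalgebra that is closed for `‖·‖₂`. (For a finite von Neumann algebra with a faithful normal
trace, a unital `*`-subalgebra is strongly closed if and only if it is `‖·‖₂`-closed.) -/
def IsVNSubalgebra (S : StarSubalgebra ℂ (UProd n ω)) : Prop :=
  ∀ x : UProd n ω, (∀ ε : ℝ, 0 < ε → ∃ a ∈ S, unorm2 (x - a) < ε) → x ∈ S

/-- `A(u)`: the von Neumann subalgebra generated by `u`. -/
def vnAlg (u : UProd n ω) : StarSubalgebra ℂ (UProd n ω) :=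
  sInf {S | IsVNSubalgebra S ∧ u ∈ S}

theorem mem_vnAlg (u : UProd n ω) : u ∈ vnAlg u :=
  StarSubalgebra.mem_sInf.2 fun _ hS => hS.2

/-- The Borel `σ`-algebra of `S¹`. -/
instance : MeasurableSpace Circle := borel Circle

instance : BorelSpace Circle := ⟨rfl⟩

/-- `μ` is an associated measure of the unitary `u`: a Borel measure on `S¹`, concentrated on the
spectrum `σ(u)`, such that `(A(u), Tr)` is isomorphic to `(L^∞(μ), ∫ · dμ)` by a `*`-isomorphism
which takes `u` to the function `z ↦ z` and the trace to the integral. -/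
def IsAssociatedMeasure (u : unitary (UProd n ω)) (μ : Measure Circle) : Prop :=
  μ {z : Circle | (z : ℂ) ∉ spectrum ℂ (u : UProd n ω)} = 0 ∧
  ∃ Φ : vnAlg (u : UProd n ω) ≃ₗ[ℂ] Lp ℂ ∞ μ,
    (∀ a b, ⇑(Φ (a * b)) =ᵐ[μ] fun z => Φ a z * Φ b z) ∧
    (∀ a, ⇑(Φ (star a)) =ᵐ[μ] fun z => star (Φ a z)) ∧
    ⇑(Φ ⟨u, mem_vnAlg _⟩) =ᵐ[μ] (fun z : Circle => (z : ℂ)) ∧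
    ∀ a : vnAlg (u : UProd n ω), Tr (a : UProd n ω) = ∫ z, Φ a z ∂μ

end MatrixUltraproduct

end

noncomputable section

namespace MatrixUltraproduct

/-! ### Trace and trace norm of the ultraproduct -/

section

variable {n : ℕ → ℕ+} {ω : Ultrafilter ℕ}

/-! A unitary `u` lifts to unitary matrices `W_k diag(e_k) W_k^*` (`exists_mkUnitary_eq`,
`exists_conjDiag_of_unitary`). By weak compactness their eigenvalue distributions converge along `ω`
to a probability measure `μ` on the circle. Applying continuous functions to the eigenvalues gives a
`*`-homomorphism `F` from `C(S¹)` with `Tr (F f) = ∫ f dμ`, so `F` is isometric from the `L²(μ)`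
norm to the trace norm.

`A(u)` is the trace-norm closure of the range of `F`, so each of its elements corresponds to an
`L²(μ)` function. That function is bounded because multiplication by an element of `M` is bounded
for the trace norm (`IsL2Value.memLp_top`). Conversely, every bounded function has a value in `M`,
because operator-norm balls are complete for the trace norm (`exists_limit_of_cauchy`). This
identifies `A(u)` with `L^∞(μ)`.

An associated measure is unique because the traces of the powers of `u` are its Fourier coefficients
(`measure_ext_of_moments`); these are conjugation invariant. For the converse, two families of
eigenvalues with the same limit distribution fill each cell of a fine partition in asymptotically
equal proportions. Permutations then match them up to a vanishing mean square distance
(`exists_perm_tendsto`), and a permutation of eigenvalues can be absorbed into the diagonalizing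
unitary. -/

theorem UProd.mk_surjective (a : UProd n ω) : ∃ x : BddSeq n, UProd.mk x = a :=
  Quotient.inductionOn' a fun x => ⟨x, rfl⟩

theorem UProd.mk_eq_mk {x y : BddSeq n} :
    (UProd.mk x : UProd n ω) = UProd.mk y ↔ Tendsto (fun k => norm2 (x k - y k)) ω (𝓝 0) :=
  (nullCon n ω).eq

theorem UProd.mk_add (x y : BddSeq n) : (UProd.mk (x + y) : UProd n ω) = UProd.mk x + UProd.mk y := rfl
theorem UProd.mk_mul (x y : BddSeq n) : (UProd.mk (x * y) : UProd n ω) = UProd.mk x * UProd.mk y := rfl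
theorem UProd.mk_sub (x y : BddSeq n) : (UProd.mk (x - y) : UProd n ω) = UProd.mk x - UProd.mk y := rfl
theorem UProd.mk_zero : (UProd.mk 0 : UProd n ω) = 0 := rfl
theorem UProd.mk_one : (UProd.mk 1 : UProd n ω) = 1 := rfl
theorem UProd.mk_star (x : BddSeq n) : (UProd.mk (star x) : UProd n ω) = star (UProd.mk x) := rfl
theorem UProd.mk_smul (c : ℂ) (x : BddSeq n) : (UProd.mk (c • x) : UProd n ω) = c • UProd.mk x := rfl

theorem BddSeq.mul_apply (x y : BddSeq n) (k : ℕ) : (x * y) k = x k * y k := rfl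
theorem BddSeq.one_apply (k : ℕ) : (1 : BddSeq n) k = 1 := rfl
theorem BddSeq.add_apply (x y : BddSeq n) (k : ℕ) : (x + y) k = x k + y k := rfl
theorem BddSeq.sub_apply (x y : BddSeq n) (k : ℕ) : (x - y) k = x k - y k := rfl
theorem BddSeq.smul_apply (c : ℂ) (x : BddSeq n) (k : ℕ) : (c • x) k = c • x k := rfl
theorem BddSeq.star_apply (x : BddSeq n) (k : ℕ) : (star x) k = star (x k) := rfl

theorem ntr_add {m : ℕ+} (A B : Mat m) : ntr (A + B) = ntr A + ntr B := by simp [ntr, mul_add]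
theorem ntr_smul {m : ℕ+} (c : ℂ) (A : Mat m) : ntr (c • A) = c * ntr A := by
  simp [ntr, mul_left_comm]
theorem ntr_one {m : ℕ+} : ntr (1 : Mat m) = 1 := by simp [ntr]
theorem ntr_mul_comm {m : ℕ+} (A B : Mat m) : ntr (A * B) = ntr (B * A) := by
  rw [ntr, ntr, Matrix.trace_mul_comm]

theorem ntr_star_mul_self {m : ℕ+} (A : Mat m) : ntr (star A * A) = ((norm2 A ^ 2 : ℝ) : ℂ) := by
  rw [norm2, Real.sq_sqrt (by positivity), ntr, Matrix.trace, Finset.sum_comm]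
  push_cast
  congr 1
  refine Finset.sum_congr rfl fun i _ => ?_
  rw [Matrix.diag_apply, Matrix.mul_apply]
  refine Finset.sum_congr rfl fun j _ => ?_
  rw [Matrix.star_apply]
  exact_mod_cast Complex.conj_mul' (A j i)

theorem norm2_one {m : ℕ+} : norm2 (1 : Mat m) = 1 := by
  have h := ntr_star_mul_self (1 : Mat m)
  rw [star_one, one_mul, ntr_one] at h
  have h' : norm2 (1 : Mat m) ^ 2 = 1 := by exact_mod_cast h.symm
  exact (pow_eq_one_iff_of_nonneg (norm2_nonneg _) two_ne_zero).1 h'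

theorem norm2_le_norm {m : ℕ+} (A : Mat m) : norm2 A ≤ ‖A‖ := by
  simpa [norm2_one] using norm2_mul_le_left A 1

theorem norm_ntr_le_norm {m : ℕ+} (A : Mat m) : ‖ntr A‖ ≤ ‖A‖ := (norm_ntr_le A).trans (norm2_le_norm A)

theorem BddSeq.norm_apply_le (x : BddSeq n) (k : ℕ) : ‖x k‖ ≤ ‖x‖ :=
  lp.norm_apply_le_norm ENNReal.top_ne_zero x k

/-- The normalized traces of a bounded sequence converge along `ω` to the trace of its class. -/
theorem tendsto_ntr (x : BddSeq n) :
    Tendsto (fun k => ntr (x k)) ω (𝓝 (Tr (UProd.mk x : UProd n ω))) := by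
  have hc : IsCompact (Metric.closedBall (0 : ℂ) ‖x‖) := isCompact_closedBall _ _
  have hm : (ω.map fun k => ntr (x k) : Ultrafilter ℂ) ≤ 𝓟 (Metric.closedBall (0 : ℂ) ‖x‖) := by
    rw [le_principal_iff]
    refine Ultrafilter.mem_map.2 (univ_mem' fun k => ?_)
    simpa using (norm_ntr_le_norm _).trans (x.norm_apply_le k)
  obtain ⟨l, -, hl⟩ := hc.ultrafilter_le_nhds _ hm
  exact tendsto_nhds_limUnder ⟨l, hl⟩

theorem Tr_mk_eq {x : BddSeq n} {l : ℂ} (h : Tendsto (fun k => ntr (x k)) ω (𝓝 l)) :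
    Tr (UProd.mk x : UProd n ω) = l :=
  tendsto_nhds_unique (tendsto_ntr x) h

theorem Tr_add (a b : UProd n ω) : Tr (a + b) = Tr a + Tr b := by
  obtain ⟨x, rfl⟩ := a.mk_surjective
  obtain ⟨y, rfl⟩ := b.mk_surjective
  rw [← UProd.mk_add]
  refine Tr_mk_eq ?_
  simpa only [BddSeq.add_apply, ntr_add] using (tendsto_ntr x).add (tendsto_ntr y)

theorem Tr_smul (c : ℂ) (a : UProd n ω) : Tr (c • a) = c * Tr a := by
  obtain ⟨x, rfl⟩ := a.mk_surjective
  rw [← UProd.mk_smul]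
  refine Tr_mk_eq ?_
  simpa only [BddSeq.smul_apply, ntr_smul] using (tendsto_ntr x).const_mul c

theorem Tr_sub (a b : UProd n ω) : Tr (a - b) = Tr a - Tr b := by
  rw [sub_eq_add_neg, Tr_add, ← neg_one_smul ℂ b, Tr_smul]
  ring

theorem Tr_one : Tr (1 : UProd n ω) = 1 := by
  rw [← UProd.mk_one]
  refine Tr_mk_eq ?_
  simpa only [BddSeq.one_apply, ntr_one] using tendsto_const_nhds

theorem Tr_mul_comm (a b : UProd n ω) : Tr (a * b) = Tr (b * a) := by
  obtain ⟨x, rfl⟩ := a.mk_surjective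
  obtain ⟨y, rfl⟩ := b.mk_surjective
  rw [← UProd.mk_mul]
  refine Tr_mk_eq ?_
  simp only [BddSeq.mul_apply, ntr_mul_comm (x _)]
  exact tendsto_ntr (y * x)

theorem tendsto_norm2 (x : BddSeq n) :
    Tendsto (fun k => norm2 (x k)) ω (𝓝 (unorm2 (UProd.mk x : UProd n ω))) := by
  have h : Tendsto (fun k => ntr ((star x * x) k)) ω (𝓝 (Tr (UProd.mk (star x * x) : UProd n ω))) :=
    tendsto_ntr _
  have h2 := (Real.continuous_sqrt.tendsto _).comp ((Complex.continuous_re.tendsto _).comp h)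
  refine h2.congr fun k => ?_
  simp only [Function.comp_apply, BddSeq.mul_apply, BddSeq.star_apply, ntr_star_mul_self,
    Complex.ofReal_re, Real.sqrt_sq (norm2_nonneg _)]

theorem unorm2_nonneg (a : UProd n ω) : 0 ≤ unorm2 a := Real.sqrt_nonneg _

theorem Tr_star_mul_self (a : UProd n ω) : Tr (star a * a) = ((unorm2 a ^ 2 : ℝ) : ℂ) := by
  obtain ⟨x, rfl⟩ := a.mk_surjective
  rw [← UProd.mk_star, ← UProd.mk_mul]
  refine Tr_mk_eq ?_
  simp only [BddSeq.mul_apply, BddSeq.star_apply, ntr_star_mul_self]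
  exact (Complex.continuous_ofReal.tendsto _).comp ((tendsto_norm2 x).pow 2)

theorem unorm2_mk_eq {x : BddSeq n} {l : ℝ} (h : Tendsto (fun k => norm2 (x k)) ω (𝓝 l)) :
    unorm2 (UProd.mk x : UProd n ω) = l :=
  tendsto_nhds_unique (tendsto_norm2 x) h

theorem unorm2_eq_zero {a : UProd n ω} : unorm2 a = 0 ↔ a = 0 := by
  obtain ⟨x, rfl⟩ := a.mk_surjective
  rw [← UProd.mk_zero, UProd.mk_eq_mk]
  simp only [show ∀ k, (0 : BddSeq n) k = 0 from fun _ => rfl, sub_zero]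
  exact ⟨fun h => h ▸ tendsto_norm2 x, unorm2_mk_eq⟩

theorem unorm2_zero : unorm2 (0 : UProd n ω) = 0 := unorm2_eq_zero.2 rfl

theorem unorm2_add_le (a b : UProd n ω) : unorm2 (a + b) ≤ unorm2 a + unorm2 b := by
  obtain ⟨x, rfl⟩ := a.mk_surjective
  obtain ⟨y, rfl⟩ := b.mk_surjective
  exact le_of_tendsto_of_tendsto' (tendsto_norm2 (x + y)) ((tendsto_norm2 x).add (tendsto_norm2 y))
    fun k => norm2_add_le _ _

theorem unorm2_neg (a : UProd n ω) : unorm2 (-a) = unorm2 a := by simp [unorm2]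

theorem unorm2_sub_comm (a b : UProd n ω) : unorm2 (a - b) = unorm2 (b - a) := by
  rw [← unorm2_neg, neg_sub]

theorem unorm2_sub_le (a b c : UProd n ω) : unorm2 (a - c) ≤ unorm2 (a - b) + unorm2 (b - c) := by
  simpa using unorm2_add_le (a - b) (b - c)

theorem unorm2_star (a : UProd n ω) : unorm2 (star a) = unorm2 a := by
  rw [unorm2, unorm2, star_star, Tr_mul_comm]

theorem unorm2_smul (c : ℂ) (a : UProd n ω) : unorm2 (c • a) = ‖c‖ * unorm2 a := by
  rw [← sq_eq_sq₀ (unorm2_nonneg _) (mul_nonneg (norm_nonneg _) (unorm2_nonneg _))]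
  apply Complex.ofReal_injective
  rw [← Tr_star_mul_self, star_smul, smul_mul_smul_comm, Tr_smul, Tr_star_mul_self]
  push_cast
  rw [mul_pow, ← Complex.conj_mul' c]
  rfl

theorem unorm2_mk_mul_le (x : BddSeq n) (b : UProd n ω) :
    unorm2 (UProd.mk x * b) ≤ ‖x‖ * unorm2 b := by
  obtain ⟨y, rfl⟩ := b.mk_surjective
  exact le_of_tendsto_of_tendsto' (tendsto_norm2 (x * y)) ((tendsto_norm2 y).const_mul ‖x‖)
    fun k => (norm2_mul_le_left _ _).trans
      (mul_le_mul_of_nonneg_right (x.norm_apply_le k) (norm2_nonneg _))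

theorem unorm2_mul_mk_le (b : UProd n ω) (x : BddSeq n) :
    unorm2 (b * UProd.mk x) ≤ unorm2 b * ‖x‖ := by
  have h := unorm2_mk_mul_le (star x) (star b)
  rwa [UProd.mk_star, ← star_mul, unorm2_star, unorm2_star, norm_star, mul_comm] at h

/-- The norm of any representative serves as a bound for multiplication, so no operator norm on the
quotient is needed. Adding 1 makes the constant positive, hence safe to divide by. -/
theorem exists_unorm2_mul_le (a : UProd n ω) :
    ∃ C : ℝ, 0 < C ∧ (∀ b, unorm2 (a * b) ≤ C * unorm2 b) ∧ ∀ b, unorm2 (b * a) ≤ unorm2 b * C := by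
  obtain ⟨x, rfl⟩ := a.mk_surjective
  refine ⟨‖x‖ + 1, by positivity, fun b => ?_, fun b => ?_⟩
  · refine (unorm2_mk_mul_le x b).trans ?_
    gcongr
    exacts [unorm2_nonneg _, by linarith]
  · refine (unorm2_mul_mk_le b x).trans ?_
    gcongr
    exacts [unorm2_nonneg _, by linarith]

theorem norm_Tr_le (a : UProd n ω) : ‖Tr a‖ ≤ unorm2 a := by
  obtain ⟨x, rfl⟩ := a.mk_surjective
  exact le_of_tendsto_of_tendsto' (tendsto_ntr x).norm (tendsto_norm2 x) fun k => norm_ntr_le _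

/-- A bounded sequence of matrices, as an element of `ℓ^∞(ℕ, M_{n_k})`. -/
def BddSeq.of (x : ∀ k, Mat (n k)) (C : ℝ) (h : ∀ k, ‖x k‖ ≤ C) : BddSeq n :=
  ⟨x, memℓp_infty ⟨C, by rintro _ ⟨k, rfl⟩; exact h k⟩⟩

/-- Operator-norm balls of the ultraproduct are complete for the trace norm. -/
theorem exists_limit_of_cauchy (hω : (ω : Filter ℕ) ≤ cofinite) (x : ℕ → BddSeq n) (C : ℝ)
    (hC : ∀ j, ‖x j‖ ≤ C)
    (hx : ∀ i j, i ≤ j → unorm2 (UProd.mk (x i) - UProd.mk (x j) : UProd n ω) ≤ (1 / 2) ^ i) :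
    ∃ a : UProd n ω, ∀ i, unorm2 (a - UProd.mk (x i)) ≤ 2 * (1 / 2) ^ i := by
  classical
  -- The factor 2 turns the bound on the limit along `ω` into a strict inequality, which then holds
  -- for `ω`-almost all `k`.
  let E : ℕ → Set ℕ := fun j => {k | j ≤ k ∧ ∀ i ≤ j, norm2 (x i k - x j k) < 2 * (1 / 2) ^ i}
  have hE : ∀ j, E j ∈ (ω : Filter ℕ) := fun j => by
    have h1 : ∀ᶠ k in (ω : Filter ℕ), j ≤ k :=
      hω (by rw [Nat.cofinite_eq_atTop]; exact eventually_ge_atTop j)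
    have h2 : ∀ i ∈ Finset.range (j + 1), ∀ᶠ k in (ω : Filter ℕ),
        norm2 (x i k - x j k) < 2 * (1 / 2) ^ i := fun i hi => by
      have := (tendsto_norm2 (ω := ω) (x i - x j)).eventually_lt_const (u := 2 * (1 / 2) ^ i) (by
        rw [UProd.mk_sub]
        refine (hx i j (Nat.lt_succ_iff.1 (Finset.mem_range.1 hi))).trans_lt ?_
        have : (0 : ℝ) < (1 / 2) ^ i := by positivity
        linarith)
      exact this
    filter_upwards [h1, (Filter.eventually_all_finset _).2 h2] with k hk1 hk2
    exact ⟨hk1, fun i hi => hk2 i (Finset.mem_range.2 (Nat.lt_succ_of_le hi))⟩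
  -- Diagonal choice: at index `k` use the latest term of the sequence that is still controlled
  -- there. The condition `j ≤ k` in `E` keeps the search finite.
  let J : ℕ → ℕ := fun k => Nat.findGreatest (fun j => k ∈ E j) k
  let y : BddSeq n := BddSeq.of (fun k => x (J k) k) C fun k =>
    ((x (J k)).norm_apply_le k).trans (hC _)
  refine ⟨UProd.mk y, fun i => ?_⟩
  rw [← UProd.mk_sub]
  refine le_of_tendsto (tendsto_norm2 _) ?_
  filter_upwards [hE i] with k hk
  have h1 : i ≤ J k := Nat.le_findGreatest hk.1 hk
  have h2 : k ∈ E (J k) := Nat.findGreatest_spec (P := fun j => k ∈ E j) hk.1 hk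
  have h3 := (h2.2 i h1).le
  rw [← norm2_neg, neg_sub] at h3
  exact h3

end

/-! ### Diagonalization and lifting of unitaries -/

section

variable {n : ℕ → ℕ+} {ω : Ultrafilter ℕ}

theorem norm2_sq {m : ℕ+} (A : Mat m) : ((norm2 A ^ 2 : ℝ) : ℂ) = ntr (star A * A) :=
  (ntr_star_mul_self A).symm

theorem norm2_unitary_mul {m : ℕ+} (W : unitary (Mat m)) (A : Mat m) :
    norm2 ((W : Mat m) * A) = norm2 A := by
  rw [← sq_eq_sq₀ (norm2_nonneg _) (norm2_nonneg _)]
  apply Complex.ofReal_injective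
  rw [norm2_sq, norm2_sq, star_mul, mul_assoc, ← mul_assoc (star (W : Mat m)),
    Unitary.star_mul_self_of_mem W.2, one_mul]

theorem norm2_mul_star_unitary {m : ℕ+} (W : unitary (Mat m)) (A : Mat m) :
    norm2 (A * star (W : Mat m)) = norm2 A := by
  rw [← norm2_star, star_mul, star_star, norm2_unitary_mul, norm2_star]

theorem norm2_diagonal {m : ℕ+} (d : Fin m → ℂ) :
    norm2 (Matrix.diagonal d : Mat m) = √(((m : ℕ) : ℝ)⁻¹ * ∑ i, ‖d i‖ ^ 2) := by
  rw [norm2]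
  congr 2
  refine Finset.sum_congr rfl fun i _ => ?_
  rw [Finset.sum_eq_single i (fun j _ hj => by simp [Matrix.diagonal_apply_ne' _ hj]) (by simp)]
  simp

/-- The matrix `W * diag(d) * W^*`. -/
def conjDiag {m : ℕ+} (W : unitary (Mat m)) (d : Fin m → ℂ) : Mat m :=
  (W : Mat m) * Matrix.diagonal d * star (W : Mat m)

theorem norm_conjDiag {m : ℕ+} (W : unitary (Mat m)) (d : Fin m → ℂ) : ‖conjDiag W d‖ = ‖d‖ := by
  rw [conjDiag, CStarRing.norm_mul_mem_unitary _ (Unitary.star_mem W.2),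
    CStarRing.norm_mem_unitary_mul _ W.2, Matrix.l2_opNorm_diagonal]

theorem norm2_conjDiag {m : ℕ+} (W : unitary (Mat m)) (d : Fin m → ℂ) :
    norm2 (conjDiag W d) = √(((m : ℕ) : ℝ)⁻¹ * ∑ i, ‖d i‖ ^ 2) := by
  rw [conjDiag, norm2_mul_star_unitary, norm2_unitary_mul, norm2_diagonal]

theorem conjDiag_mul {m : ℕ+} (W : unitary (Mat m)) (c d : Fin m → ℂ) :
    conjDiag W (c * d) = conjDiag W c * conjDiag W d := by
  have h : Matrix.diagonal (c * d) = Matrix.diagonal c * Matrix.diagonal d :=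
    (Matrix.diagonal_mul_diagonal c d).symm
  simp only [conjDiag, h, mul_assoc]
  rw [← mul_assoc (star (W : Mat m)) W, Unitary.star_mul_self_of_mem W.2, one_mul]

theorem conjDiag_add {m : ℕ+} (W : unitary (Mat m)) (c d : Fin m → ℂ) :
    conjDiag W (c + d) = conjDiag W c + conjDiag W d := by
  have h : Matrix.diagonal (c + d) = Matrix.diagonal c + Matrix.diagonal d :=
    (Matrix.diagonal_add c d).symm
  simp only [conjDiag, h, mul_add, add_mul]

theorem conjDiag_sub {m : ℕ+} (W : unitary (Mat m)) (c d : Fin m → ℂ) :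
    conjDiag W (c - d) = conjDiag W c - conjDiag W d := by
  rw [eq_sub_iff_add_eq, ← conjDiag_add, sub_add_cancel]

theorem conjDiag_smul {m : ℕ+} (W : unitary (Mat m)) (c : ℂ) (d : Fin m → ℂ) :
    conjDiag W (c • d) = c • conjDiag W d := by
  simp only [conjDiag, Matrix.diagonal_smul, mul_smul_comm, smul_mul_assoc]

theorem conjDiag_one {m : ℕ+} (W : unitary (Mat m)) : conjDiag W 1 = 1 := by
  rw [conjDiag, show Matrix.diagonal (1 : Fin m → ℂ) = 1 from Matrix.diagonal_one, mul_one, Unitary.mul_star_self_of_mem W.2]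

theorem conjDiag_star {m : ℕ+} (W : unitary (Mat m)) (d : Fin m → ℂ) :
    conjDiag W (star d) = star (conjDiag W d) := by
  rw [conjDiag, conjDiag, star_mul, star_mul, star_star, mul_assoc,
    Matrix.star_eq_conjTranspose (Matrix.diagonal d), Matrix.diagonal_conjTranspose]

theorem ntr_conjDiag {m : ℕ+} (W : unitary (Mat m)) (d : Fin m → ℂ) :
    ntr (conjDiag W d) = ((m : ℕ) : ℂ)⁻¹ * ∑ i, d i := by
  rw [conjDiag, ntr_mul_comm, ← mul_assoc, Unitary.star_mul_self_of_mem W.2, one_mul, ntr,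
    Matrix.trace_diagonal]

theorem exists_conjDiag_of_isHermitian {m : ℕ+} {A : Mat m} (hA : A.IsHermitian) :
    ∃ W : unitary (Mat m), A = conjDiag W fun i => (hA.eigenvalues i : ℂ) :=
  ⟨hA.eigenvectorUnitary, by
    conv_lhs => rw [hA.spectral_theorem]
    rfl⟩

/-- Unitary matrices are unitarily diagonalizable. -/
theorem exists_conjDiag_of_unitary {m : ℕ+} (U : unitary (Mat m)) :
    ∃ (W : unitary (Mat m)) (e : Fin m → Circle), (U : Mat m) = conjDiag W fun i => (e i : ℂ) := by
  have hfin : (spectrum ℂ (U : Mat m)).Finite := Matrix.finite_spectrum _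
  have hn : IsStarNormal (U : Mat m) :=
    ⟨(Unitary.star_mul_self_of_mem U.2).trans (Unitary.mul_star_self_of_mem U.2).symm⟩
  -- Writing `U = exp(iH)` with `H = arg U` self-adjoint reduces to the Hermitian spectral theorem.
  -- The jump of `arg` is harmless on a finite spectrum.
  let H : Mat m := cfc (fun z : ℂ => ((Complex.arg z : ℝ) : ℂ)) (U : Mat m)
  have hH : IsSelfAdjoint H := IsSelfAdjoint.cfc_arg (U : Mat m)
  have hcont : ∀ f : ℂ → ℂ, ContinuousOn f (spectrum ℂ (U : Mat m)) := fun f => hfin.continuousOn f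
  have hUH : NormedSpace.exp (Complex.I • H) = (U : Mat m) := by
    simp only [H]
    rw [← CFC.exp_eq_normedSpace_exp (𝕜 := ℂ) (ha := hH.isStarNormal.smul _), ← cfc_smul _ _ _ (hcont _),
      ← cfc_comp' _ _ _ (by fun_prop) (hcont _)]
    conv_rhs => rw [← cfc_id' ℂ (U : Mat m)]
    refine cfc_congr fun z hz => ?_
    change NormedSpace.exp (Complex.I • ((Complex.arg z : ℝ) : ℂ)) = z
    rw [← Complex.exp_eq_exp_ℂ, smul_eq_mul, mul_comm]
    simpa [spectrum.norm_eq_one_of_unitary U.2 hz] using Complex.norm_mul_exp_arg_mul_I z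
  have hH' := Matrix.isHermitian_iff_isSelfAdjoint.2 hH
  obtain ⟨W, hd⟩ := exists_conjDiag_of_isHermitian hH'
  refine ⟨W, fun i => Circle.exp (hH'.eigenvalues i), ?_⟩
  have hW : (W : Mat m)⁻¹ = star (W : Mat m) :=
    Matrix.inv_eq_right_inv (Unitary.mul_star_self_of_mem W.2)
  have hWu : IsUnit (W : Mat m) := ⟨Unitary.toUnits W, rfl⟩
  rw [← hUH]
  conv_lhs => rw [hd]
  rw [← conjDiag_smul, conjDiag, ← hW, Matrix.exp_conj _ _ hWu, Matrix.exp_diagonal, hW, conjDiag]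
  congr 3
  funext i
  rw [Pi.coe_exp, ← Complex.exp_eq_exp_ℂ, Circle.coe_exp, Pi.smul_apply, smul_eq_mul, mul_comm]

/-- An invertible matrix `X` is as close to its unitary polar part as `X^* X` is to `1`. -/
theorem exists_unitary_norm2_sub_le {m : ℕ+} (X : Mat m) (hX : IsUnit X) :
    ∃ U : unitary (Mat m), norm2 (X - (U : Mat m)) ≤ norm2 (star X * X - 1) := by
  open scoped ComplexOrder in
  have hP : (star X * X).PosDef :=
    Matrix.PosDef.conjTranspose_mul_self X (Matrix.mulVec_injective_of_isUnit hX)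
  obtain ⟨V, hV⟩ := exists_conjDiag_of_isHermitian hP.isHermitian
  set p := hP.isHermitian.eigenvalues
  have hp : ∀ i, 0 < p i := hP.eigenvalues_pos
  let q : Fin m → ℂ := fun i => ((√(p i) : ℝ) : ℂ)
  have hq : ∀ i, q i ≠ 0 := fun i => by
    simpa [q] using (Real.sqrt_pos.2 (hp i)).ne'
  have hqq : q * q = fun i => (p i : ℂ) := by
    funext i
    simp only [Pi.mul_apply, q]
    rw [← Complex.ofReal_mul, Real.mul_self_sqrt (hp i).le]
  have hqs : star (q⁻¹) = q⁻¹ := by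
    funext i
    simp [q]
  have hqi : q⁻¹ * q = 1 := funext fun i => inv_mul_cancel₀ (hq i)
  -- The polar part `X (X^* X)^{-1/2}`.
  let U : Mat m := X * conjDiag V q⁻¹
  have hU1 : star U * U = 1 := by
    calc star U * U = conjDiag V q⁻¹ * (star X * X) * conjDiag V q⁻¹ := by
          simp only [U, star_mul, ← conjDiag_star, hqs, mul_assoc]
      _ = 1 := by
          rw [hV, ← hqq, ← conjDiag_mul, ← conjDiag_mul, ← conjDiag_one V]
          congr 1
          rw [← mul_assoc, hqi, one_mul, mul_comm, hqi]
  have hU : U ∈ unitary (Mat m) := ⟨hU1, mul_eq_one_comm.1 hU1⟩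
  refine ⟨⟨U, hU⟩, ?_⟩
  have hXU : X = U * conjDiag V q := by
    simp only [U]
    rw [mul_assoc, ← conjDiag_mul, hqi, conjDiag_one, mul_one]
  have h1 : X - U = U * conjDiag V (q - 1) := by
    rw [conjDiag_sub, conjDiag_one, mul_sub, mul_one, ← hXU]
  have h2 : star X * X - 1 = conjDiag V (q * q - 1) := by
    rw [conjDiag_sub, conjDiag_one, hqq, ← hV]
  change norm2 (X - U) ≤ _
  rw [h1, h2, norm2_unitary_mul ⟨U, hU⟩, norm2_conjDiag, norm2_conjDiag]
  gcongr with i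
  -- From `p - 1 = (√p + 1)(√p - 1)` follows `|√p - 1| ≤ |p - 1|`, eigenvalue by eigenvalue.
  have h3 : (q * q - 1) i = ((√(p i) + 1 : ℝ) : ℂ) * (q - 1) i := by
    simp only [Pi.sub_apply, Pi.mul_apply, Pi.one_apply, q]
    push_cast
    ring
  rw [h3, norm_mul, Complex.norm_real, Real.norm_of_nonneg (by positivity)]
  exact le_mul_of_one_le_left (norm_nonneg _) (by linarith [Real.sqrt_nonneg (p i)])

/-- Only finitely many shifts hit the spectrum. This makes representatives invertible, so that their
polar parts are unitary. -/
theorem exists_isUnit_add_smul_one {m : ℕ+} (X : Mat m) {δ : ℝ} (hδ : 0 < δ) :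
    ∃ r : ℝ, 0 < r ∧ r ≤ δ ∧ IsUnit (X + (r : ℂ) • (1 : Mat m)) := by
  have hfin : {r : ℝ | ((-r : ℝ) : ℂ) ∈ spectrum ℂ X}.Finite :=
    (Matrix.finite_spectrum X).preimage
      (fun a _ b _ h => neg_injective (Complex.ofReal_injective h))
  obtain ⟨r, hr, hr'⟩ := ((Set.Ioc_infinite hδ).sdiff hfin).nonempty
  refine ⟨r, hr.1, hr.2, ?_⟩
  have h := spectrum.notMem_iff.1 hr'
  rw [← IsUnit.neg_iff] at h
  convert h using 1
  rw [Algebra.algebraMap_eq_smul_one]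
  push_cast
  rw [neg_smul]
  abel

theorem norm_coe_unitary_le {m : ℕ+} (U : unitary (Mat m)) : ‖(U : Mat m)‖ ≤ 1 :=
  (CStarRing.norm_coe_unitary U).le

/-- The element of the ultraproduct represented by a sequence of unitary matrices. -/
def UProd.mkUnitary (U : ∀ k, unitary (Mat (n k))) : unitary (UProd n ω) :=
  ⟨UProd.mk (BddSeq.of (fun k => (U k : Mat (n k))) 1 fun k => norm_coe_unitary_le (U k)), by
    constructor
    · rw [← UProd.mk_star, ← UProd.mk_mul, ← UProd.mk_one]
      exact congrArg UProd.mk (Subtype.ext (funext fun k => Unitary.star_mul_self_of_mem (U k).2))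
    · rw [← UProd.mk_star, ← UProd.mk_mul, ← UProd.mk_one]
      exact congrArg UProd.mk (Subtype.ext (funext fun k => Unitary.mul_star_self_of_mem (U k).2))⟩

/-- Unitaries of the ultraproduct lift to sequences of unitary matrices. -/
theorem exists_mkUnitary_eq (hω : (ω : Filter ℕ) ≤ cofinite) (u : unitary (UProd n ω)) :
    ∃ U : ∀ k, unitary (Mat (n k)), UProd.mkUnitary U = u := by
  obtain ⟨x, hx⟩ := UProd.mk_surjective (u : UProd n ω)
  -- Shifts of size at most `1/(k+1)` vanish along the free ultrafilter and do not change the class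
  -- of `x`.
  choose r hr0 hr1 hr using fun k => exists_isUnit_add_smul_one (x k) (Nat.one_div_pos_of_nat (n := k) (α := ℝ))
  choose U hU using fun k => exists_unitary_norm2_sub_le _ (hr k)
  have hnorm : ∀ k, ‖(r k : ℂ) • (1 : Mat (n k))‖ = r k := fun k => by
    rw [norm_smul, norm_one, mul_one, Complex.norm_real, Real.norm_of_nonneg (hr0 k).le]
  have hr1' : ∀ k, ‖(r k : ℂ) • (1 : Mat (n k))‖ ≤ 1 := fun k => by
    rw [hnorm]
    exact (hr1 k).trans (by
      rw [div_le_one (by positivity)]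
      linarith [(Nat.cast_nonneg k : (0 : ℝ) ≤ k)])
  let d : BddSeq n := BddSeq.of (fun k => (r k : ℂ) • (1 : Mat (n k))) 1 hr1'
  have hd : (UProd.mk d : UProd n ω) = 0 := by
    rw [← unorm2_eq_zero]
    refine unorm2_mk_eq ?_
    have h0 : Tendsto (fun k : ℕ => 1 / ((k : ℝ) + 1)) ω (𝓝 0) :=
      tendsto_one_div_add_atTop_nhds_zero_nat.mono_left (hω.trans_eq Nat.cofinite_eq_atTop)
    exact squeeze_zero (fun k => norm2_nonneg _)
      (fun k => (norm2_le_norm _).trans ((hnorm k).le.trans (hr1 k))) h0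
  have hxd : (UProd.mk (x + d) : UProd n ω) = u := by rw [UProd.mk_add, hd, add_zero, hx]
  refine ⟨U, Subtype.ext ?_⟩
  rw [← hxd]
  refine (UProd.mk_eq_mk.2 ?_).symm
  have h1 := tendsto_norm2 (ω := ω) (star (x + d) * (x + d) - 1)
  rw [UProd.mk_sub, UProd.mk_mul, UProd.mk_star, hxd, Unitary.star_mul_self_of_mem u.2,
    UProd.mk_one, sub_self, unorm2_zero] at h1
  exact squeeze_zero (fun k => norm2_nonneg _) (fun k => hU k) h1

end

/-! ### Continuous functional calculus and eigenvalue distributions -/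

section

variable {n : ℕ → ℕ+} {ω : Ultrafilter ℕ}

theorem norm_comp_le {m : ℕ+} (e : Fin m → Circle) (f : C(Circle, ℂ)) : ‖fun i => f (e i)‖ ≤ ‖f‖ :=
  (pi_norm_le_iff_of_nonneg (norm_nonneg _)).2 fun i => f.norm_coe_le_norm (e i)

/-- The sequence of matrices `f(U_k)`, where `U_k = W_k diag(e_k) W_k^*`. -/
def fcSeq (W : ∀ k, unitary (Mat (n k))) (e : ∀ k, Fin (n k) → Circle) (f : C(Circle, ℂ)) :
    BddSeq n :=
  BddSeq.of (fun k => conjDiag (W k) fun i => f (e k i)) ‖f‖ fun k => by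
    rw [norm_conjDiag]
    exact norm_comp_le _ _

theorem fcSeq_apply (W : ∀ k, unitary (Mat (n k))) (e : ∀ k, Fin (n k) → Circle) (f : C(Circle, ℂ))
    (k : ℕ) : fcSeq W e f k = conjDiag (W k) fun i => f (e k i) := rfl

theorem norm_fcSeq_le (W : ∀ k, unitary (Mat (n k))) (e : ∀ k, Fin (n k) → Circle)
    (f : C(Circle, ℂ)) : ‖fcSeq W e f‖ ≤ ‖f‖ :=
  lp.norm_le_of_forall_le (norm_nonneg _) fun k => by
    rw [fcSeq_apply, norm_conjDiag]
    exact norm_comp_le _ _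

/-- The continuous functional calculus `f ↦ f(u)` of the class `u` of the sequence
`W_k diag(e_k) W_k^*`. -/
def fc (W : ∀ k, unitary (Mat (n k))) (e : ∀ k, Fin (n k) → Circle) :
    C(Circle, ℂ) →⋆ₐ[ℂ] UProd n ω where
  toFun f := UProd.mk (fcSeq W e f)
  map_one' := congrArg UProd.mk (Subtype.ext (funext fun k => conjDiag_one (W k)))
  map_mul' f g := congrArg UProd.mk (Subtype.ext (funext fun k => conjDiag_mul (W k) _ _))
  map_zero' := congrArg UProd.mk (Subtype.ext (funext fun k => by
    change conjDiag (W k) 0 = 0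
    simpa using conjDiag_smul (W k) 0 0))
  map_add' f g := congrArg UProd.mk (Subtype.ext (funext fun k => conjDiag_add (W k) _ _))
  commutes' c := by
    rw [Algebra.algebraMap_eq_smul_one, Algebra.algebraMap_eq_smul_one, ← UProd.mk_one,
      ← UProd.mk_smul]
    refine congrArg UProd.mk (Subtype.ext (funext fun k => ?_))
    change conjDiag (W k) (c • 1) = c • (1 : Mat (n k))
    rw [conjDiag_smul, conjDiag_one]
  map_star' f := congrArg UProd.mk (Subtype.ext (funext fun k => conjDiag_star (W k) _))

theorem unorm2_fc_le (W : ∀ k, unitary (Mat (n k))) (e : ∀ k, Fin (n k) → Circle)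
    (f : C(Circle, ℂ)) : unorm2 (fc (ω := ω) W e f) ≤ ‖f‖ :=
  le_of_tendsto' (tendsto_norm2 _) fun k =>
    (norm2_le_norm _).trans ((BddSeq.norm_apply_le _ k).trans (norm_fcSeq_le W e f))

/-- The inclusion of the circle in the complex plane. -/
def circleCoe : C(Circle, ℂ) := ⟨fun z => (z : ℂ), continuous_subtype_val⟩

theorem exists_fc_circleCoe_eq (hω : (ω : Filter ℕ) ≤ cofinite) (u : unitary (UProd n ω)) :
    ∃ (W : ∀ k, unitary (Mat (n k))) (e : ∀ k, Fin (n k) → Circle),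
      fc W e circleCoe = (u : UProd n ω) := by
  obtain ⟨U, rfl⟩ := exists_mkUnitary_eq hω u
  choose W e h using fun k => exists_conjDiag_of_unitary (U k)
  exact ⟨W, e, congrArg UProd.mk (Subtype.ext (funext fun k => (h k).symm))⟩

theorem isVNSubalgebra_vnAlg (u : UProd n ω) : IsVNSubalgebra (vnAlg u) := fun x hx =>
  StarSubalgebra.mem_sInf.2 fun S hS => hS.1 x fun ε hε => by
    obtain ⟨a, ha, h⟩ := hx ε hε
    exact ⟨a, StarSubalgebra.mem_sInf.1 ha S hS, h⟩

/-- Stone–Weierstrass: the coordinate function alone separates points. -/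
theorem starSubalgebra_eq_top_of_circleCoe_mem (S : StarSubalgebra ℂ C(Circle, ℂ))
    (hS : IsClosed (S : Set C(Circle, ℂ))) (h : circleCoe ∈ S) : S = ⊤ := by
  have h1 : S.SeparatesPoints := fun x y hxy =>
    ⟨circleCoe, ⟨circleCoe, h, rfl⟩, fun h' => hxy (Subtype.ext h')⟩
  rw [← ContinuousMap.starSubalgebra_topologicalClosure_eq_top_of_separatesPoints S h1]
  exact SetLike.coe_injective hS.closure_eq.symm

/-- The trace norm of `f(u)` is at most the sup norm of `f`, so the preimage of a von Neumann
subalgebra is uniformly closed and Stone–Weierstrass applies. -/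
theorem fc_mem_of_isVNSubalgebra (W : ∀ k, unitary (Mat (n k))) (e : ∀ k, Fin (n k) → Circle)
    {S : StarSubalgebra ℂ (UProd n ω)} (hS : IsVNSubalgebra S) (h : fc W e circleCoe ∈ S)
    (f : C(Circle, ℂ)) : fc W e f ∈ S := by
  have h1 : S.comap (fc W e) = ⊤ := by
    refine starSubalgebra_eq_top_of_circleCoe_mem _ ?_ h
    refine isClosed_of_closure_subset fun g hg => hS _ fun ε hε => ?_
    obtain ⟨g', hg', hd⟩ := Metric.mem_closure_iff.1 hg ε hε
    refine ⟨fc W e g', hg', ?_⟩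
    change unorm2 (fc W e g - fc W e g') < ε
    rw [← map_sub]
    exact (unorm2_fc_le W e _).trans_lt (by rwa [← dist_eq_norm])
  have h2 : f ∈ S.comap (fc W e) := h1 ▸ StarSubalgebra.mem_top
  exact h2

/-- The uniform distribution on a finite family of points of the circle. -/
def specMeasure {m : ℕ+} (e : Fin m → Circle) : ProbabilityMeasure Circle :=
  ⟨((m : ℕ) : ℝ≥0∞)⁻¹ • ∑ i, Measure.dirac (e i), ⟨by
    have hm : ((m : ℕ) : ℝ≥0∞) ≠ 0 := by exact_mod_cast m.ne_zero
    simp [ENNReal.inv_mul_cancel hm]⟩⟩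

theorem coe_specMeasure {m : ℕ+} (e : Fin m → Circle) :
    (specMeasure e : Measure Circle) = ((m : ℕ) : ℝ≥0∞)⁻¹ • ∑ i, Measure.dirac (e i) := rfl

theorem integral_specMeasure {m : ℕ+} (e : Fin m → Circle) (f : C(Circle, ℂ)) :
    ∫ z, f z ∂(specMeasure e : Measure Circle) = ((m : ℕ) : ℂ)⁻¹ * ∑ i, f (e i) := by
  rw [coe_specMeasure, integral_smul_measure, integral_finsetSum_measure
    fun i _ => integrable_dirac (by simp)]
  simp [integral_dirac]

/-- The probability measures on a compact metric space are weakly compact, so every ultrafilter on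
them converges. -/
theorem exists_tendsto_specMeasure (ω : Ultrafilter ℕ) (e : ∀ k, Fin (n k) → Circle) :
    ∃ μ : ProbabilityMeasure Circle, Tendsto (fun k => specMeasure (e k)) ω (𝓝 μ) := by
  obtain ⟨μ, -, hμ⟩ := isCompact_univ.ultrafilter_le_nhds
    (ω.map fun k => specMeasure (e k)) (by simp)
  exact ⟨μ, hμ⟩

theorem Tr_fc (W : ∀ k, unitary (Mat (n k))) {e : ∀ k, Fin (n k) → Circle}
    {μ : ProbabilityMeasure Circle} (h : Tendsto (fun k => specMeasure (e k)) ω (𝓝 μ))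
    (f : C(Circle, ℂ)) : Tr (fc (ω := ω) W e f) = ∫ z, f z ∂(μ : Measure Circle) := by
  refine Tr_mk_eq ?_
  have h1 := (ProbabilityMeasure.tendsto_iff_forall_integral_rclike_tendsto ℂ).1 h
    (BoundedContinuousFunction.mkOfCompact f)
  refine h1.congr fun k => ?_
  rw [fcSeq_apply, ntr_conjDiag]
  exact integral_specMeasure _ f

/-- Apply the trace formula to `|f|²`, using that the calculus is a `*`-homomorphism. -/
theorem ofReal_unorm2_fc (W : ∀ k, unitary (Mat (n k))) {e : ∀ k, Fin (n k) → Circle}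
    {μ : ProbabilityMeasure Circle} (h : Tendsto (fun k => specMeasure (e k)) ω (𝓝 μ))
    (f : C(Circle, ℂ)) :
    ENNReal.ofReal (unorm2 (fc (ω := ω) W e f)) = eLpNorm f 2 (μ : Measure Circle) := by
  have h1 : unorm2 (fc (ω := ω) W e f) ^ 2 = ∫ z, ‖f z‖ ^ 2 ∂(μ : Measure Circle) := by
    apply Complex.ofReal_injective
    rw [← Tr_star_mul_self, ← map_star, ← map_mul, Tr_fc W h, ← integral_complex_ofReal]
    congr 1
    funext z
    rw [Complex.ofReal_pow, ← Complex.conj_mul']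
    rfl
  have hf : MemLp f 2 (μ : Measure Circle) :=
    MemLp.of_bound f.continuous.aestronglyMeasurable ‖f‖ (ae_of_all _ f.norm_coe_le_norm)
  rw [hf.eLpNorm_eq_integral_rpow_norm two_ne_zero ENNReal.ofNat_ne_top]
  simp only [ENNReal.toReal_ofNat, Real.rpow_ofNat]
  rw [← h1, ← one_div, ← Real.sqrt_eq_rpow, Real.sqrt_sq (unorm2_nonneg _)]

end

/-! ### Extension of the calculus by `L²`-continuity -/

section

variable {n : ℕ → ℕ+} {ω : Ultrafilter ℕ}

/-- A continuous functional calculus which is isometric for the trace norm and `L²(μ)`. -/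
structure IsTracialCalculus (F : C(Circle, ℂ) →⋆ₐ[ℂ] UProd n ω) (μ : Measure Circle) : Prop where
  Tr_apply : ∀ f, Tr (F f) = ∫ z, f z ∂μ
  ofReal_unorm2 : ∀ f, ENNReal.ofReal (unorm2 (F f)) = eLpNorm f 2 μ
  -- Plays the role of contractivity for the operator norm: it makes multiplication by `F f` bounded
  -- by `‖f‖` in the trace norm.
  exists_lift : ∀ f, ∃ x : BddSeq n, ‖x‖ ≤ ‖f‖ ∧ UProd.mk x = F f

theorem isTracialCalculus_fc (W : ∀ k, unitary (Mat (n k))) {e : ∀ k, Fin (n k) → Circle}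
    {μ : ProbabilityMeasure Circle} (h : Tendsto (fun k => specMeasure (e k)) ω (𝓝 μ)) :
    IsTracialCalculus (fc (ω := ω) W e) (μ : Measure Circle) where
  Tr_apply := Tr_fc W h
  ofReal_unorm2 := ofReal_unorm2_fc W h
  exists_lift f := ⟨fcSeq W e f, norm_fcSeq_le W e f, rfl⟩

/-- `a` is the value at `g` of the `L²`-continuous extension of the functional calculus `F`. -/
def IsL2Value (F : C(Circle, ℂ) →⋆ₐ[ℂ] UProd n ω) (μ : Measure Circle) (g : Circle → ℂ)
    (a : UProd n ω) : Prop :=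
  ∀ ε : ℝ, 0 < ε → ∃ f : C(Circle, ℂ),
    eLpNorm (fun z => g z - f z) 2 μ ≤ ENNReal.ofReal ε ∧ unorm2 (a - F f) ≤ ε

variable {F : C(Circle, ℂ) →⋆ₐ[ℂ] UProd n ω} {μ : Measure Circle} {g g' : Circle → ℂ}
  {a a' : UProd n ω}

theorem aesm_continuousMap (f : C(Circle, ℂ)) : AEStronglyMeasurable (fun z => f z) μ :=
  f.continuous.aestronglyMeasurable

theorem IsL2Value.apply (f : C(Circle, ℂ)) : IsL2Value F μ f (F f) := fun ε hε =>
  ⟨f, by simp, by simpa [unorm2_zero] using hε.le⟩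

theorem IsL2Value.congr (h : IsL2Value F μ g a) (hg : g =ᵐ[μ] g') : IsL2Value F μ g' a := by
  intro ε hε
  obtain ⟨f, h1, h2⟩ := h ε hε
  refine ⟨f, (eLpNorm_congr_ae ?_).trans_le h1, h2⟩
  filter_upwards [hg] with z hz
  rw [hz]

theorem IsL2Value.add (h : IsL2Value F μ g a) (h' : IsL2Value F μ g' a')
    (hg : AEStronglyMeasurable g μ) (hg' : AEStronglyMeasurable g' μ) :
    IsL2Value F μ (fun z => g z + g' z) (a + a') := by
  intro ε hε
  obtain ⟨f, h1, h2⟩ := h (ε / 2) (by linarith)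
  obtain ⟨f', h1', h2'⟩ := h' (ε / 2) (by linarith)
  refine ⟨f + f', ?_, ?_⟩
  · have e1 : (fun z => g z + g' z - (f + f') z) =
        (fun z => g z - f z) + fun z => g' z - f' z := by
      funext z
      simp only [ContinuousMap.add_apply, Pi.add_apply]
      ring
    rw [e1]
    refine (eLpNorm_add_le (hg.sub (aesm_continuousMap f)) (hg'.sub (aesm_continuousMap f'))
      one_le_two).trans ((add_le_add h1 h1').trans_eq ?_)
    rw [← ENNReal.ofReal_add (by linarith) (by linarith), add_halves]
  · rw [map_add, add_sub_add_comm]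
    linarith [unorm2_add_le (a - F f) (a' - F f')]

theorem IsL2Value.smul (h : IsL2Value F μ g a) (c : ℂ) :
    IsL2Value F μ (fun z => c * g z) (c • a) := by
  intro ε hε
  have hc : 0 < ‖c‖ + 1 := by positivity
  have hε' : ‖c‖ * (ε / (‖c‖ + 1)) ≤ ε := by
    rw [mul_div_assoc', div_le_iff₀ hc]
    nlinarith
  obtain ⟨f, h1, h2⟩ := h (ε / (‖c‖ + 1)) (by positivity)
  refine ⟨c • f, ?_, ?_⟩
  · refine (eLpNorm_le_mul_eLpNorm_of_ae_le_mul (c := ‖c‖) (g := fun z => g z - f z)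
      (ae_of_all _ fun z => ?_) 2).trans ?_
    · rw [← norm_mul, mul_sub]
      rfl
    · refine (mul_le_mul_right h1 _).trans ?_
      rw [← ENNReal.ofReal_mul (norm_nonneg _)]
      exact ENNReal.ofReal_le_ofReal hε'
  · rw [map_smul, ← smul_sub, unorm2_smul]
    exact (mul_le_mul_of_nonneg_left h2 (norm_nonneg _)).trans hε'

theorem IsL2Value.star (h : IsL2Value F μ g a) :
    IsL2Value F μ (fun z => star (g z)) (star a) := by
  intro ε hε
  obtain ⟨f, h1, h2⟩ := h ε hε
  refine ⟨Star.star f, ?_, ?_⟩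
  · refine (eLpNorm_congr_norm_ae (ae_of_all _ fun z => ?_)).trans_le h1
    rw [ContinuousMap.star_apply, ← star_sub, norm_star]
  · rwa [map_star, ← star_sub, unorm2_star]

theorem IsTracialCalculus.unorm2_mul_le (hF : IsTracialCalculus F μ) (b : UProd n ω)
    (f : C(Circle, ℂ)) : unorm2 (F f * b) ≤ ‖f‖ * unorm2 b := by
  obtain ⟨x, hx, hx'⟩ := hF.exists_lift f
  rw [← hx']
  exact (unorm2_mk_mul_le x b).trans (mul_le_mul_of_nonneg_right hx (unorm2_nonneg _))

/-- Uses `gg' - ff' = (g - f)g' + f(g' - f')` and its analogue in the ultraproduct. Boundedness of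
`g'` and of multiplication by `a'` controls the first term; `f'` is chosen after `f`, with precision
depending on `‖f‖`, to control the second. -/
theorem IsL2Value.mul (hF : IsTracialCalculus F μ) (h : IsL2Value F μ g a)
    (h' : IsL2Value F μ g' a') (hg : AEStronglyMeasurable g μ) (hg' : MemLp g' ∞ μ) :
    IsL2Value F μ (fun z => g z * g' z) (a * a') := by
  intro ε hε
  obtain ⟨C, hC, -, hC'⟩ := exists_unorm2_mul_le a'
  set D := (eLpNormEssSup g' μ).toReal
  have hD : ∀ᵐ z ∂μ, ‖g' z‖ ≤ D := by
    filter_upwards [ae_le_eLpNormEssSup (f := g') (μ := μ)] with z hz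
    have hfin : eLpNormEssSup g' μ ≠ ∞ := by simpa using hg'.2.ne
    have := ENNReal.toReal_mono hfin hz
    simpa using this
  have hD0 : 0 ≤ D := ENNReal.toReal_nonneg
  set δ := ε / 2 / (C + D + 1)
  have hδ : 0 < δ := by positivity
  have hCδ : C * δ ≤ ε / 2 := by
    rw [mul_div_assoc', div_le_iff₀ (by positivity)]
    nlinarith
  have hDδ : D * δ ≤ ε / 2 := by
    rw [mul_div_assoc', div_le_iff₀ (by positivity)]
    nlinarith
  obtain ⟨f, h1, h2⟩ := h δ hδ
  set δ' := ε / 2 / (‖f‖ + 1)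
  have hfδ : ‖f‖ * δ' ≤ ε / 2 := by
    rw [mul_div_assoc', div_le_iff₀ (by positivity)]
    nlinarith
  obtain ⟨f', h1', h2'⟩ := h' δ' (by positivity)
  refine ⟨f * f', ?_, ?_⟩
  · have e1 : (fun z => g z * g' z - (f * f') z) =
        (fun z => (g z - f z) * g' z) + fun z => f z * (g' z - f' z) := by
      funext z
      simp only [ContinuousMap.mul_apply, Pi.add_apply]
      ring
    rw [e1]
    refine (eLpNorm_add_le ((hg.sub (aesm_continuousMap f)).mul hg'.1)
      ((aesm_continuousMap f).mul (hg'.1.sub (aesm_continuousMap f'))) one_le_two).trans ?_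
    rw [← add_halves ε, ENNReal.ofReal_add (by linarith) (by linarith)]
    refine add_le_add ?_ ?_
    · refine (eLpNorm_le_mul_eLpNorm_of_ae_le_mul (c := D) (g := fun z => g z - f z) ?_ 2).trans ?_
      · filter_upwards [hD] with z hz
        change ‖(g z - f z) * g' z‖ ≤ _
        rw [norm_mul, mul_comm]
        exact mul_le_mul_of_nonneg_right hz (norm_nonneg _)
      · refine (mul_le_mul_right h1 _).trans ?_
        rw [← ENNReal.ofReal_mul hD0]
        exact ENNReal.ofReal_le_ofReal hDδ
    · refine (eLpNorm_le_mul_eLpNorm_of_ae_le_mul (c := ‖f‖) (g := fun z => g' z - f' z)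
        (ae_of_all _ fun z => ?_) 2).trans ?_
      · change ‖f z * (g' z - f' z)‖ ≤ _
        rw [norm_mul]
        exact mul_le_mul_of_nonneg_right (f.norm_coe_le_norm z) (norm_nonneg _)
      · refine (mul_le_mul_right h1' _).trans ?_
        rw [← ENNReal.ofReal_mul (norm_nonneg _)]
        exact ENNReal.ofReal_le_ofReal hfδ
  · have e1 : a * a' - F (f * f') = (a - F f) * a' + F f * (a' - F f') := by
      rw [map_mul]
      noncomm_ring
    rw [e1]
    have i1 : unorm2 ((a - F f) * a') ≤ δ * C :=
      (hC' _).trans (mul_le_mul_of_nonneg_right h2 hC.le)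
    have i2 : unorm2 (F f * (a' - F f')) ≤ ‖f‖ * δ' :=
      (hF.unorm2_mul_le _ f).trans (mul_le_mul_of_nonneg_left h2' (norm_nonneg _))
    linarith [unorm2_add_le ((a - F f) * a') (F f * (a' - F f'))]

/-- The isometry passes to limits. Applied to differences, it makes function and element determine
each other. -/
theorem IsL2Value.ofReal_unorm2 (hF : IsTracialCalculus F μ) (h : IsL2Value F μ g a)
    (hg : AEStronglyMeasurable g μ) : ENNReal.ofReal (unorm2 a) = eLpNorm g 2 μ := by
  have key : ∀ ε : NNReal, 0 < ε → ENNReal.ofReal (unorm2 a) ≤ eLpNorm g 2 μ + ε ∧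
      eLpNorm g 2 μ ≤ ENNReal.ofReal (unorm2 a) + ε := by
    intro ε hε
    obtain ⟨f, h1, h2⟩ := h (ε / 2) (by positivity)
    have e2 : ENNReal.ofReal (ε / 2) + ENNReal.ofReal (ε / 2) = ε := by
      rw [← ENNReal.ofReal_add (by positivity) (by positivity), add_halves, ENNReal.ofReal_coe_nnreal]
    have h1' : eLpNorm (fun z => f z - g z) 2 μ ≤ ENNReal.ofReal (ε / 2) := by
      refine (eLpNorm_congr_norm_ae (ae_of_all _ fun z => ?_)).trans_le h1
      rw [norm_sub_rev]
    constructor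
    · have i1 : unorm2 a ≤ unorm2 (F f) + ε / 2 := by
        have := unorm2_add_le (F f) (a - F f)
        rw [add_sub_cancel] at this
        linarith
      have i2 := eLpNorm_add_le hg ((aesm_continuousMap (μ := μ) f).sub hg) one_le_two
      have e3 : (g + fun z => f z - g z) = f := by
        funext z
        simp
      rw [Pi.sub_def, e3] at i2
      calc ENNReal.ofReal (unorm2 a) ≤ ENNReal.ofReal (unorm2 (F f) + ε / 2) :=
            ENNReal.ofReal_le_ofReal i1
        _ = eLpNorm f 2 μ + ENNReal.ofReal (ε / 2) := by
            rw [ENNReal.ofReal_add (unorm2_nonneg _) (by positivity), hF.ofReal_unorm2]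
        _ ≤ eLpNorm g 2 μ + ENNReal.ofReal (ε / 2) + ENNReal.ofReal (ε / 2) := by
            gcongr
            exact i2.trans (by gcongr)
        _ = eLpNorm g 2 μ + ε := by rw [add_assoc, e2]
    · have i1 : unorm2 (F f) ≤ unorm2 a + ε / 2 := by
        have := unorm2_add_le a (F f - a)
        rw [add_sub_cancel, unorm2_sub_comm] at this
        linarith
      have i2 := eLpNorm_add_le (aesm_continuousMap (μ := μ) f)
        (hg.sub (aesm_continuousMap (μ := μ) f)) one_le_two
      have e3 : ((fun z => f z) + fun z => g z - f z) = g := by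
        funext z
        simp
      rw [Pi.sub_def, e3] at i2
      calc eLpNorm g 2 μ ≤ eLpNorm f 2 μ + ENNReal.ofReal (ε / 2) := i2.trans (by gcongr)
        _ = ENNReal.ofReal (unorm2 (F f)) + ENNReal.ofReal (ε / 2) := by rw [hF.ofReal_unorm2]
        _ ≤ ENNReal.ofReal (unorm2 a + ε / 2) + ENNReal.ofReal (ε / 2) := by
            gcongr
        _ = ENNReal.ofReal (unorm2 a) + ε := by
            rw [ENNReal.ofReal_add (unorm2_nonneg _) (by positivity), add_assoc, e2]
  exact le_antisymm (ENNReal.le_of_forall_pos_le_add fun ε hε _ => (key ε hε).1)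
    (ENNReal.le_of_forall_pos_le_add fun ε hε _ => (key ε hε).2)

theorem IsL2Value.sub (h : IsL2Value F μ g a) (h' : IsL2Value F μ g' a')
    (hg : AEStronglyMeasurable g μ) (hg' : AEStronglyMeasurable g' μ) :
    IsL2Value F μ (fun z => g z - g' z) (a - a') := by
  simpa [sub_eq_add_neg] using h.add (h'.smul (-1)) hg (hg'.const_mul (-1))

theorem IsL2Value.value_unique (hF : IsTracialCalculus F μ) (h : IsL2Value F μ g a)
    (h' : IsL2Value F μ g a') (hg : AEStronglyMeasurable g μ) : a = a' := by
  have h1 := (h.sub h' hg hg).ofReal_unorm2 hF (hg.sub hg)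
  simp only [sub_self] at h1
  rw [← sub_eq_zero, ← unorm2_eq_zero]
  refine le_antisymm ?_ (unorm2_nonneg _)
  simpa using h1

theorem IsL2Value.ae_unique (hF : IsTracialCalculus F μ) (h : IsL2Value F μ g a)
    (h' : IsL2Value F μ g' a) (hg : AEStronglyMeasurable g μ) (hg' : AEStronglyMeasurable g' μ) :
    g =ᵐ[μ] g' := by
  have hm : AEStronglyMeasurable (fun z => g z - g' z) μ := hg.sub hg'
  have h1 := (h.sub h' hg hg').ofReal_unorm2 hF hm
  rw [sub_self, unorm2_zero, ENNReal.ofReal_zero, eq_comm,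
    eLpNorm_eq_zero_iff hm two_ne_zero] at h1
  filter_upwards [h1] with z hz
  exact sub_eq_zero.1 hz

theorem IsL2Value.Tr_eq [IsProbabilityMeasure μ] (hF : IsTracialCalculus F μ)
    (h : IsL2Value F μ g a) (hg : MemLp g 2 μ) : Tr a = ∫ z, g z ∂μ := by
  rw [← sub_eq_zero, ← norm_le_zero_iff]
  refine le_of_forall_pos_le_add fun ε hε => ?_
  obtain ⟨f, h1, h2⟩ := h (ε / 2) (by positivity)
  have hf : MemLp f 2 μ :=
    MemLp.of_bound f.continuous.aestronglyMeasurable ‖f‖ (ae_of_all _ f.norm_coe_le_norm)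
  have e1 : Tr a - ∫ z, g z ∂μ = Tr (a - F f) - ∫ z, (g z - f z) ∂μ := by
    rw [Tr_sub, hF.Tr_apply, integral_sub (hg.integrable one_le_two) (hf.integrable one_le_two)]
    ring
  have i1 : ‖∫ z, (g z - f z) ∂μ‖ ≤ ε / 2 := by
    have hint : Integrable (fun z => g z - f z) μ := (hg.sub hf).integrable one_le_two
    refine (norm_integral_le_integral_norm _).trans ?_
    rw [← ENNReal.ofReal_le_ofReal_iff (by positivity), ofReal_integral_norm_eq_lintegral_enorm hint,
      ← eLpNorm_one_eq_lintegral_enorm]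
    exact (eLpNorm_le_eLpNorm_of_exponent_le one_le_two hint.1).trans h1
  rw [e1, zero_add]
  linarith [norm_sub_le (Tr (a - F f)) (∫ z, (g z - f z) ∂μ), norm_Tr_le (a - F f)]

end

/-! ### Bounded functions and elements of the ultraproduct -/

section

variable {n : ℕ → ℕ+} {ω : Ultrafilter ℕ}
variable {F : C(Circle, ℂ) →⋆ₐ[ℂ] UProd n ω} {μ : Measure Circle} {g g' : Circle → ℂ}
  {a a' : UProd n ω}

theorem abs_clip_sub_le {C x y : ℝ} (hy : |y| ≤ C) : |max (-C) (min C x) - y| ≤ |x - y| := by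
  have h := abs_le.1 hy
  have e : max (-C) (min C y) = y := by rw [min_eq_right h.2, max_eq_right h.1]
  calc |max (-C) (min C x) - y| = |max (-C) (min C x) - max (-C) (min C y)| := by rw [e]
    _ ≤ |min C x - min C y| := by
        simpa [max_comm] using abs_max_sub_max_le_abs (min C x) (min C y) (-C)
    _ ≤ |x - y| := by
        simpa [min_comm] using abs_min_sub_min_le_max C x C y

/-- Clipping an `L²`-approximation to `[-C, C]` brings it no further from `g`, as `g` already takes
values there. The uniform bound on `f` is what completeness of operator-norm balls requires. -/
theorem exists_continuous_approx [IsProbabilityMeasure μ] {g : Circle → ℝ}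
    (hg : AEStronglyMeasurable g μ) {C : ℝ} (hC : ∀ᵐ z ∂μ, |g z| ≤ C) {ε : ℝ} (hε : 0 < ε) :
    ∃ f : C(Circle, ℂ), ‖f‖ ≤ C ∧
      eLpNorm (fun z => (g z : ℂ) - f z) 2 μ ≤ ENNReal.ofReal ε := by
  have hC0 : 0 ≤ C := by
    obtain ⟨z, hz⟩ := hC.exists
    exact (abs_nonneg _).trans hz
  obtain ⟨f, hf, -⟩ := (MemLp.of_bound (p := 2) hg C hC).exists_boundedContinuous_eLpNorm_sub_le
    ENNReal.ofNat_ne_top (ENNReal.ofReal_pos.2 hε).ne'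
  let f' : C(Circle, ℂ) := ⟨fun z => ((max (-C) (min C (f z)) : ℝ) : ℂ), by fun_prop⟩
  refine ⟨f', (ContinuousMap.norm_le _ hC0).2 fun z => ?_, ?_⟩
  · change ‖((max (-C) (min C (f z)) : ℝ) : ℂ)‖ ≤ C
    rw [Complex.norm_real, Real.norm_eq_abs, abs_le]
    exact ⟨le_max_left _ _, max_le (by linarith) (min_le_left _ _)⟩
  · refine (eLpNorm_mono_ae ?_).trans hf
    filter_upwards [hC] with z hz
    change ‖(g z : ℂ) - ((max (-C) (min C (f z)) : ℝ) : ℂ)‖ ≤ ‖g z - f z‖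
    rw [← Complex.ofReal_sub, Complex.norm_real, norm_sub_rev, norm_sub_rev (g z)]
    exact abs_clip_sub_le hz

theorem exists_isL2Value_ofReal (hω : (ω : Filter ℕ) ≤ cofinite) [IsProbabilityMeasure μ]
    (hF : IsTracialCalculus F μ) {g : Circle → ℝ} (hg : AEStronglyMeasurable g μ) {C : ℝ}
    (hC : ∀ᵐ z ∂μ, |g z| ≤ C) : ∃ a, IsL2Value F μ (fun z => (g z : ℂ)) a := by
  -- With this rate the `i`-th and `j`-th approximants differ by at most `(1/2)^i` for `i ≤ j`, as
  -- `exists_limit_of_cauchy` demands.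
  choose f hf1 hf2 using fun j : ℕ => exists_continuous_approx hg hC
    (show (0 : ℝ) < (1 / 2) ^ (j + 1) by positivity)
  choose x hx1 hx2 using fun j => hF.exists_lift (f j)
  have hgc : AEStronglyMeasurable (fun z => (g z : ℂ)) μ :=
    Complex.continuous_ofReal.comp_aestronglyMeasurable hg
  obtain ⟨a, ha⟩ := exists_limit_of_cauchy hω x C (fun j => (hx1 j).trans (hf1 j)) fun i j hij => by
    rw [hx2, hx2, ← map_sub, ← ENNReal.ofReal_le_ofReal_iff (by positivity), hF.ofReal_unorm2]
    have e1 : ⇑(f i - f j) = (fun z => (g z : ℂ) - f j z) - fun z => (g z : ℂ) - f i z := by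
      funext z
      simp
    rw [e1]
    refine (eLpNorm_sub_le (hgc.sub (aesm_continuousMap _)) (hgc.sub (aesm_continuousMap _))
      one_le_two).trans ((add_le_add (hf2 j) (hf2 i)).trans ?_)
    rw [← ENNReal.ofReal_add (by positivity) (by positivity)]
    refine ENNReal.ofReal_le_ofReal ?_
    have h1 : (1 / 2 : ℝ) ^ (j + 1) ≤ (1 / 2) ^ (i + 1) :=
      pow_le_pow_of_le_one (by norm_num) (by norm_num) (by omega)
    calc (1 / 2 : ℝ) ^ (j + 1) + (1 / 2) ^ (i + 1) ≤ (1 / 2) ^ (i + 1) + (1 / 2) ^ (i + 1) := by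
          gcongr
      _ = (1 / 2) ^ i := by ring
  refine ⟨a, fun ε hε => ?_⟩
  obtain ⟨j, hj⟩ := exists_pow_lt_of_lt_one (show 0 < ε / 2 by positivity)
    (show (1 / 2 : ℝ) < 1 by norm_num)
  have hp : (0 : ℝ) < (1 / 2) ^ j := by positivity
  refine ⟨f j, (hf2 j).trans (ENNReal.ofReal_le_ofReal ?_), ?_⟩
  · rw [pow_succ]
    linarith
  · rw [← hx2]
    linarith [ha j]

theorem ae_norm_le_of_memLp_top (hg : MemLp g ∞ μ) :
    ∀ᵐ z ∂μ, ‖g z‖ ≤ (eLpNormEssSup g μ).toReal := by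
  filter_upwards [ae_le_eLpNormEssSup (f := g) (μ := μ)] with z hz
  simpa using ENNReal.toReal_mono (by simpa using hg.2.ne) hz

/-- Every function in `L^∞(μ)` has a value in the ultraproduct. -/
theorem exists_isL2Value (hω : (ω : Filter ℕ) ≤ cofinite) [IsProbabilityMeasure μ]
    (hF : IsTracialCalculus F μ) (hg : MemLp g ∞ μ) : ∃ a, IsL2Value F μ g a := by
  have hb := ae_norm_le_of_memLp_top hg
  have hre : AEStronglyMeasurable (fun z => (g z).re) μ :=
    Complex.continuous_re.comp_aestronglyMeasurable hg.1
  have him : AEStronglyMeasurable (fun z => (g z).im) μ :=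
    Complex.continuous_im.comp_aestronglyMeasurable hg.1
  obtain ⟨a, ha⟩ := exists_isL2Value_ofReal hω hF hre
    (hb.mono fun z hz => (Complex.abs_re_le_norm _).trans hz)
  obtain ⟨b, hb⟩ := exists_isL2Value_ofReal hω hF him
    (hb.mono fun z hz => (Complex.abs_im_le_norm _).trans hz)
  refine ⟨a + Complex.I • b, ?_⟩
  refine (ha.add (hb.smul Complex.I) (Complex.continuous_ofReal.comp_aestronglyMeasurable hre)
    ((Complex.continuous_ofReal.comp_aestronglyMeasurable him).const_mul _)).congr
    (ae_of_all _ fun z => ?_)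
  change ((g z).re : ℂ) + Complex.I * (g z).im = g z
  rw [mul_comm, Complex.re_add_im]

/-- By the isometry, approximants of `a` in trace norm are Cauchy in `L²(μ)`. They carry no uniform
bound, so their limit is only square integrable at this stage. -/
theorem exists_memLp_two_isL2Value [IsProbabilityMeasure μ] (hF : IsTracialCalculus F μ)
    (ha : ∀ ε : ℝ, 0 < ε → ∃ f, unorm2 (a - F f) < ε) : ∃ g, MemLp g 2 μ ∧ IsL2Value F μ g a := by
  choose f hf using fun j : ℕ => ha ((1 / 2) ^ (j + 1)) (by positivity)
  have hfm : ∀ j, MemLp (f j) 2 μ := fun j =>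
    MemLp.of_bound (f j).continuous.aestronglyMeasurable ‖f j‖ (ae_of_all _ (f j).norm_coe_le_norm)
  let y : ℕ → Lp ℂ 2 μ := fun j => (hfm j).toLp
  have hd : ∀ i j, dist (y i) (y j) = unorm2 (F (f i) - F (f j)) := fun i j => by
    rw [dist_eq_norm, ← MemLp.toLp_sub, Lp.norm_toLp, ← map_sub,
      ← ENNReal.toReal_ofReal (unorm2_nonneg _), hF.ofReal_unorm2]
    rfl
  have hy : CauchySeq y := cauchySeq_of_le_geometric (1 / 2) 1 (by norm_num) fun j => by
    rw [hd]
    have h1 := unorm2_sub_le (F (f j)) a (F (f (j + 1)))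
    rw [unorm2_sub_comm (F (f j)) a] at h1
    have h2 := hf j
    have h3 := hf (j + 1)
    have hp : (0 : ℝ) < (1 / 2) ^ j := by positivity
    rw [pow_succ, pow_succ] at h3
    rw [pow_succ] at h2
    linarith
  obtain ⟨g, hg⟩ := cauchySeq_tendsto_of_complete hy
  refine ⟨g, Lp.memLp g, fun ε hε => ?_⟩
  obtain ⟨N, hN⟩ := Metric.tendsto_atTop.1 hg ε hε
  obtain ⟨j, hj⟩ := exists_pow_lt_of_lt_one hε (show (1 / 2 : ℝ) < 1 by norm_num)
  refine ⟨f (max N j), ?_, ?_⟩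
  · have h1 := (hN (max N j) (le_max_left _ _)).le
    rw [dist_comm, Lp.dist_def] at h1
    have h2 : eLpNorm (⇑g - ⇑(y (max N j))) 2 μ ≠ ∞ :=
      ((Lp.memLp g).sub (Lp.memLp _)).2.ne
    rw [← ENNReal.le_ofReal_iff_toReal_le h2 hε.le] at h1
    refine (eLpNorm_congr_ae ?_).trans_le h1
    filter_upwards [(hfm (max N j)).coeFn_toLp] with z hz
    exact congrArg (g z - ·) hz.symm
  · refine (hf _).le.trans (le_trans ?_ hj.le)
    exact pow_le_pow_of_le_one (by norm_num) (by norm_num) ((le_max_right _ _).trans (Nat.le_succ _))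

/-- A square-integrable function with a value in the ultraproduct is essentially bounded. -/
theorem IsL2Value.memLp_top (hω : (ω : Filter ℕ) ≤ cofinite) [IsProbabilityMeasure μ]
    (hF : IsTracialCalculus F μ) (h : IsL2Value F μ g a) (hg : AEStronglyMeasurable g μ) :
    MemLp g ∞ μ := by
  obtain ⟨C, hC0, hC, -⟩ := exists_unorm2_mul_le a
  suffices hs : ∀ g', StronglyMeasurable g' → IsL2Value F μ g' a → MemLp g' ∞ μ from
    (memLp_congr_ae hg.ae_eq_mk).2 (hs _ hg.stronglyMeasurable_mk (h.congr hg.ae_eq_mk))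
  intro g hg h
  -- Let `b` be the value at the indicator of `E`. Then `(C + 1)‖b‖₂ ≤ ‖ab‖₂ ≤ C‖b‖₂`, so `b = 0`
  -- and `E` is null.
  let E : Set Circle := {z | C + 1 ≤ ‖g z‖}
  have hE : MeasurableSet E := measurableSet_le measurable_const hg.norm.measurable
  let χ : Circle → ℂ := E.indicator fun _ => 1
  have hχ : MemLp χ ∞ μ := (memLp_const 1).indicator hE
  obtain ⟨b, hb⟩ := exists_isL2Value hω hF hχ
  have h1 := (h.mul hF hb hg.aestronglyMeasurable hχ).ofReal_unorm2 hF
    (hg.aestronglyMeasurable.mul hχ.1)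
  have h2 := hb.ofReal_unorm2 hF hχ.1
  have h3 : eLpNorm χ 2 μ ≤ ENNReal.ofReal (C + 1)⁻¹ * eLpNorm (fun z => g z * χ z) 2 μ := by
    refine eLpNorm_le_mul_eLpNorm_of_ae_le_mul (ae_of_all _ fun z => ?_) 2
    by_cases hz : z ∈ E
    · simp only [χ, Set.indicator_of_mem hz, mul_one, norm_one]
      rw [inv_mul_eq_div, one_le_div (by positivity)]
      exact hz
    · simp [χ, Set.indicator_of_notMem hz]
  rw [← h1, ← h2, ← ENNReal.ofReal_mul (by positivity), ENNReal.ofReal_le_ofReal_iff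
    (mul_nonneg (by positivity) (unorm2_nonneg _))] at h3
  have h4 : unorm2 b = 0 := by
    have h5 := h3.trans (mul_le_mul_of_nonneg_left (hC b) (by positivity))
    rw [inv_mul_eq_div, le_div_iff₀ (by positivity)] at h5
    linarith [unorm2_nonneg b]
  rw [h4, ENNReal.ofReal_zero, eq_comm, eLpNorm_eq_zero_iff hχ.1 two_ne_zero] at h2
  refine memLp_top_of_bound hg.aestronglyMeasurable (C + 1) ?_
  filter_upwards [h2] with z hz
  by_contra hcon
  have hzE : z ∈ E := (not_le.1 hcon).le
  simp [χ, Set.indicator_of_mem hzE] at hz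

end

/-! ### The isomorphism of `A(u)` with `L^∞(μ)` and the spectrum -/

section

variable {n : ℕ → ℕ+} {ω : Ultrafilter ℕ}
variable {F : C(Circle, ℂ) →⋆ₐ[ℂ] UProd n ω} {μ : Measure Circle} {g g' : Circle → ℂ}
  {a a' : UProd n ω}

/-- The `‖·‖₂`-closure of a unital `*`-subalgebra of the ultraproduct. -/
def l2Closure (S : StarSubalgebra ℂ (UProd n ω)) : StarSubalgebra ℂ (UProd n ω) where
  carrier := {a | ∀ ε : ℝ, 0 < ε → ∃ s ∈ S, unorm2 (a - s) < ε}
  algebraMap_mem' c ε hε := ⟨algebraMap ℂ _ c, S.algebraMap_mem c, by rwa [sub_self, unorm2_zero]⟩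
  add_mem' {a b} ha hb ε hε := by
    obtain ⟨s, hs, h1⟩ := ha (ε / 2) (by positivity)
    obtain ⟨t, ht, h2⟩ := hb (ε / 2) (by positivity)
    refine ⟨s + t, add_mem hs ht, ?_⟩
    rw [add_sub_add_comm]
    linarith [unorm2_add_le (a - s) (b - t)]
  mul_mem' {a b} ha hb ε hε := by
    obtain ⟨C, hC, hC1, -⟩ := exists_unorm2_mul_le a
    -- `t` comes before `s`, because the precision for `s` depends on the multiplication bound of
    -- `t`.
    obtain ⟨t, ht, h2⟩ := hb (ε / 2 / C) (by positivity)
    obtain ⟨D, hD, -, hD1⟩ := exists_unorm2_mul_le t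
    obtain ⟨s, hs, h1⟩ := ha (ε / 2 / D) (by positivity)
    refine ⟨s * t, mul_mem hs ht, ?_⟩
    have e1 : a * b - s * t = a * (b - t) + (a - s) * t := by noncomm_ring
    rw [e1]
    rw [lt_div_iff₀ hC] at h2
    rw [lt_div_iff₀ hD] at h1
    linarith [unorm2_add_le (a * (b - t)) ((a - s) * t), hC1 (b - t), hD1 (a - s)]
  star_mem' {a} ha ε hε := by
    obtain ⟨s, hs, h1⟩ := ha ε hε
    exact ⟨star s, star_mem hs, by rwa [← star_sub, unorm2_star]⟩

theorem isVNSubalgebra_l2Closure (S : StarSubalgebra ℂ (UProd n ω)) :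
    IsVNSubalgebra (l2Closure S) := fun x hx ε hε => by
  obtain ⟨a, ha, h1⟩ := hx (ε / 2) (by positivity)
  obtain ⟨s, hs, h2⟩ := ha (ε / 2) (by positivity)
  exact ⟨s, hs, by linarith [unorm2_sub_le x a s]⟩

/-- The closure of the range of `F` is itself a von Neumann subalgebra containing the generator, so
it contains all of `A(u)`. -/
theorem exists_fc_of_mem_vnAlg (ha : a ∈ vnAlg (F circleCoe)) :
    ∀ ε : ℝ, 0 < ε → ∃ f, unorm2 (a - F f) < ε := by
  have h1 : a ∈ l2Closure F.range := StarSubalgebra.mem_sInf.1 ha _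
    ⟨isVNSubalgebra_l2Closure _, fun ε hε =>
      ⟨F circleCoe, ⟨_, rfl⟩, by rwa [sub_self, unorm2_zero]⟩⟩
  intro ε hε
  obtain ⟨_, ⟨f, rfl⟩, hf⟩ := h1 ε hε
  exact ⟨f, hf⟩

theorem IsL2Value.mem_of_isVNSubalgebra {S : StarSubalgebra ℂ (UProd n ω)} (hS : IsVNSubalgebra S)
    (hFS : ∀ f, F f ∈ S) (h : IsL2Value F μ g a) : a ∈ S := hS a fun ε hε => by
  obtain ⟨f, -, hf⟩ := h (ε / 2) (by positivity)
  exact ⟨F f, hFS f, by linarith⟩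

theorem exists_Lp_top_isL2Value (hω : (ω : Filter ℕ) ≤ cofinite) [IsProbabilityMeasure μ]
    (hF : IsTracialCalculus F μ) (ha : a ∈ vnAlg (F circleCoe)) :
    ∃ g : Lp ℂ ∞ μ, IsL2Value F μ g a := by
  obtain ⟨g, hg, hga⟩ := exists_memLp_two_isL2Value hF (exists_fc_of_mem_vnAlg ha)
  have hg' := hga.memLp_top hω hF hg.1
  exact ⟨hg'.toLp, hga.congr hg'.coeFn_toLp.symm⟩

theorem Lp.aesm (g : Lp ℂ ∞ μ) : AEStronglyMeasurable g μ := Lp.aestronglyMeasurable g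

/-- The isomorphism of `A(u)` with `L^∞(μ)`. -/
theorem exists_linearEquiv_Lp_top (hω : (ω : Filter ℕ) ≤ cofinite) [IsProbabilityMeasure μ]
    (hF : IsTracialCalculus F μ) (hFmem : ∀ f, F f ∈ vnAlg (F circleCoe)) :
    ∃ Φ : vnAlg (F circleCoe) ≃ₗ[ℂ] Lp ℂ ∞ μ, ∀ a, IsL2Value F μ (Φ a) (a : UProd n ω) := by
  choose φ hφ using fun a : vnAlg (F circleCoe) => exists_Lp_top_isL2Value hω hF a.2
  have huniq : ∀ (a : vnAlg (F circleCoe)) (g : Lp ℂ ∞ μ), IsL2Value F μ g (a : UProd n ω) →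
      φ a = g := fun a g h => Lp.ext ((hφ a).ae_unique hF h (Lp.aesm _) (Lp.aesm _))
  let L : vnAlg (F circleCoe) →ₗ[ℂ] Lp ℂ ∞ μ :=
    { toFun := φ
      map_add' := fun a b => huniq _ _ (((hφ a).add (hφ b) (Lp.aesm _) (Lp.aesm _)).congr
        (Lp.coeFn_add _ _).symm)
      map_smul' := fun c a => huniq _ _ (((hφ a).smul c).congr
        (Lp.coeFn_smul (E := ℂ) c (φ a)).symm) }
  have hL : Function.Bijective L := by
    constructor
    · intro a b hab
      have hab' : φ a = φ b := hab
      have hb := hφ b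
      rw [← hab'] at hb
      exact Subtype.ext ((hφ a).value_unique hF hb (Lp.aesm _))
    · intro g
      obtain ⟨a, ha⟩ := exists_isL2Value hω hF (Lp.memLp g)
      exact ⟨⟨a, ha.mem_of_isVNSubalgebra (isVNSubalgebra_vnAlg _) hFmem⟩, huniq _ _ ha⟩
  exact ⟨LinearEquiv.ofBijective L hL, hφ⟩

/-- It suffices to find a null ball around each `z₀` off the spectrum. Let `C` bound multiplication
by `(z₀ - u)⁻¹` and let `f` be a bump function on the ball of radius `r = 1/(2C)`. Then `‖F f‖₂ ≤
C‖(z₀ - u) F f‖₂ ≤ C r ‖F f‖₂ = ‖F f‖₂ / 2`, so `f` vanishes almost everywhere. -/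
theorem IsTracialCalculus.measure_compl_spectrum (hF : IsTracialCalculus F μ) :
    μ {z : Circle | (z : ℂ) ∉ spectrum ℂ (F circleCoe)} = 0 := by
  refine measure_null_of_locally_null _ fun z₀ hz₀ => ?_
  obtain ⟨v, hv⟩ := spectrum.notMem_iff.1 hz₀
  obtain ⟨C, hC, hC1, -⟩ := exists_unorm2_mul_le ((v⁻¹ : (UProd n ω)ˣ) : UProd n ω)
  set r : ℝ := 1 / (2 * C)
  have hr : 0 < r := by positivity
  refine ⟨Metric.ball z₀ r, mem_nhdsWithin_of_mem_nhds (Metric.ball_mem_nhds _ hr), ?_⟩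
  let f : C(Circle, ℂ) := ⟨fun z => ((max 0 (r - dist z z₀) : ℝ) : ℂ), by fun_prop⟩
  let q : C(Circle, ℂ) := ⟨fun z => (z₀ : ℂ) - z, by fun_prop⟩
  have hq : F q = v := by
    have e1 : q = algebraMap ℂ C(Circle, ℂ) z₀ - circleCoe := rfl
    rw [hv, e1, map_sub, AlgHomClass.commutes]
  have h1 : unorm2 (F f) ≤ C * unorm2 (F (q * f)) := by
    have := hC1 (F (q * f))
    rwa [map_mul, hq, ← mul_assoc, Units.inv_mul, one_mul, ← hq, ← map_mul] at this
  have h2 : unorm2 (F (q * f)) ≤ r * unorm2 (F f) := by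
    rw [← ENNReal.ofReal_le_ofReal_iff (mul_nonneg hr.le (unorm2_nonneg _)),
      ENNReal.ofReal_mul hr.le, hF.ofReal_unorm2, hF.ofReal_unorm2]
    refine eLpNorm_le_mul_eLpNorm_of_ae_le_mul (ae_of_all _ fun z => ?_) 2
    change ‖((z₀ : ℂ) - z) * f z‖ ≤ _
    rw [norm_mul]
    by_cases hz : dist z z₀ ≤ r
    · refine mul_le_mul_of_nonneg_right ?_ (norm_nonneg _)
      rwa [norm_sub_rev, ← dist_eq_norm]
    · have : f z = 0 := by
        change ((max 0 (r - dist z z₀) : ℝ) : ℂ) = 0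
        rw [max_eq_left (by linarith), Complex.ofReal_zero]
      simp [this]
  have h3 : unorm2 (F f) = 0 := by
    have h4 := h1.trans (mul_le_mul_of_nonneg_left h2 hC.le)
    have e1 : C * (r * unorm2 (F f)) = unorm2 (F f) / 2 := by
      simp only [r]
      field_simp
    linarith [unorm2_nonneg (F f)]
  have h4 := hF.ofReal_unorm2 f
  rw [h3, ENNReal.ofReal_zero, eq_comm, eLpNorm_eq_zero_iff (aesm_continuousMap f) two_ne_zero] at h4
  refine measure_mono_null (fun z hz => ?_) (ae_iff.1 h4)
  change ¬ (((max 0 (r - dist z z₀) : ℝ) : ℂ) = 0)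
  rw [Metric.mem_ball] at hz
  rw [max_eq_right (by linarith), Complex.ofReal_eq_zero]
  linarith

theorem isAssociatedMeasure_of_isTracialCalculus (hω : (ω : Filter ℕ) ≤ cofinite)
    [IsProbabilityMeasure μ] (hF : IsTracialCalculus F μ)
    (hFmem : ∀ f, F f ∈ vnAlg (F circleCoe)) (u : unitary (UProd n ω))
    (hu : F circleCoe = (u : UProd n ω)) : IsAssociatedMeasure u μ := by
  obtain ⟨u, hu'⟩ := u
  obtain rfl : F circleCoe = u := hu
  obtain ⟨Φ, hΦ⟩ := exists_linearEquiv_Lp_top hω hF hFmem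
  refine ⟨hF.measure_compl_spectrum, Φ, fun a b => ?_, fun a => ?_, ?_, fun a => ?_⟩
  · exact (hΦ (a * b)).ae_unique hF ((hΦ a).mul hF (hΦ b) (Lp.aesm _) (Lp.memLp _)) (Lp.aesm _)
      ((Lp.aesm _).mul (Lp.aesm _))
  · exact (hΦ (star a)).ae_unique hF (hΦ a).star (Lp.aesm _)
      (continuous_star.comp_aestronglyMeasurable (Lp.aesm _))
  · exact (hΦ _).ae_unique hF (IsL2Value.apply circleCoe) (Lp.aesm _)
      (aesm_continuousMap circleCoe)
  · exact (hΦ a).Tr_eq hF ((Lp.memLp _).mono_exponent le_top)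

/-- Every limit of the eigenvalue distributions is an associated measure. -/
theorem exists_isAssociatedMeasure (hω : (ω : Filter ℕ) ≤ cofinite) (u : unitary (UProd n ω)) :
    ∃ (W : ∀ k, unitary (Mat (n k))) (e : ∀ k, Fin (n k) → Circle) (μ : ProbabilityMeasure Circle),
      fc W e circleCoe = (u : UProd n ω) ∧ Tendsto (fun k => specMeasure (e k)) ω (𝓝 μ) ∧
      IsAssociatedMeasure u (μ : Measure Circle) := by
  obtain ⟨W, e, hu⟩ := exists_fc_circleCoe_eq hω u
  obtain ⟨μ, hμ⟩ := exists_tendsto_specMeasure ω e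
  exact ⟨W, e, μ, hu, hμ, isAssociatedMeasure_of_isTracialCalculus hω (isTracialCalculus_fc W hμ)
    (fun f => fc_mem_of_isVNSubalgebra W e (isVNSubalgebra_vnAlg _) (mem_vnAlg _) f) u hu⟩

end

/-! ### Moments and uniqueness of the associated measure -/

section

variable {n : ℕ → ℕ+} {ω : Ultrafilter ℕ} {u v : unitary (UProd n ω)} {μ ν : Measure Circle}

/-- Unitality follows from surjectivity: multiply `Φ 1` by the preimage of the constant 1, which is
in `L^∞(μ)` even before `μ` is known to be finite. -/
theorem ae_eq_one_of_map_mul {u : UProd n ω} (Φ : vnAlg u ≃ₗ[ℂ] Lp ℂ ∞ μ)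
    (hmul : ∀ a b, ⇑(Φ (a * b)) =ᵐ[μ] fun z => Φ a z * Φ b z) : ⇑(Φ 1) =ᵐ[μ] fun _ => (1 : ℂ) := by
  obtain ⟨a, ha⟩ := Φ.surjective (memLp_top_const (1 : ℂ)).toLp
  have h1 := hmul 1 a
  rw [one_mul, ha] at h1
  filter_upwards [h1, (memLp_top_const (μ := μ) (1 : ℂ)).coeFn_toLp] with z hz hz'
  rw [hz', mul_one] at hz
  exact hz.symm

theorem IsAssociatedMeasure.isProbabilityMeasure (h : IsAssociatedMeasure u μ) :
    IsProbabilityMeasure μ := by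
  obtain ⟨-, Φ, hmul, -, -, hTr⟩ := h
  have hone := ae_eq_one_of_map_mul Φ hmul
  have h2 := hTr 1
  rw [OneMemClass.coe_one, Tr_one, integral_congr_ae hone, integral_const, Complex.real_smul,
    mul_one] at h2
  have h3 : μ.real Set.univ = 1 := by exact_mod_cast h2.symm
  -- Infinite mass is excluded, since `∞.toReal = 0`.
  exact ⟨(ENNReal.toReal_eq_one_iff _).1 h3⟩

theorem IsAssociatedMeasure.integral_zpow (h : IsAssociatedMeasure u μ) (m : ℤ) :
    ∫ z : Circle, (z : ℂ) ^ m ∂μ = Tr ((u ^ m : unitary (UProd n ω)) : UProd n ω) := by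
  have hprob := h.isProbabilityMeasure
  obtain ⟨-, Φ, hmul, hstar, hu, hTr⟩ := h
  set U : vnAlg (u : UProd n ω) := ⟨u, mem_vnAlg _⟩
  have hone := ae_eq_one_of_map_mul Φ hmul
  have hpow : ∀ k : ℕ, ⇑(Φ (U ^ k)) =ᵐ[μ] fun z : Circle => (z : ℂ) ^ k := by
    intro k
    induction k with
    | zero => simpa using hone
    | succ k ih =>
      rw [pow_succ]
      filter_upwards [hmul (U ^ k) U, ih, hu] with z h1 h2 h3
      rw [h1, h2, h3, pow_succ]
  obtain ⟨k, rfl | rfl⟩ := m.eq_nat_or_neg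
  · simp only [zpow_natCast]
    exact (integral_congr_ae (hpow k)).symm.trans (hTr (U ^ k)).symm
  -- Negative powers come from the adjoint, as conjugation is inversion on the circle.
  · have h1 : ⇑(Φ (star (U ^ k))) =ᵐ[μ] fun z : Circle => (z : ℂ) ^ (-(k : ℤ)) := by
      filter_upwards [hstar (U ^ k), hpow k] with z h1 h2
      rw [h1, h2, star_pow, zpow_neg, zpow_natCast, ← inv_pow, ← Circle.coe_inv, Circle.coe_inv_eq_conj]
      rfl
    rw [← integral_congr_ae h1, ← hTr, zpow_neg, zpow_natCast]
    rfl

/-- The `*`-algebra generated by the coordinate function separates points, hence determines finite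
measures, and it is spanned by the monomials `z ^ m`. -/
theorem measure_ext_of_moments [IsFiniteMeasure μ] [IsFiniteMeasure ν]
    (h : ∀ m : ℤ, ∫ z : Circle, (z : ℂ) ^ m ∂μ = ∫ z : Circle, (z : ℂ) ^ m ∂ν) : μ = ν := by
  let c : BoundedContinuousFunction Circle ℂ := BoundedContinuousFunction.mkOfCompact circleCoe
  refine ext_of_forall_mem_subalgebra_integral_eq_of_polish (𝕜 := ℂ)
    (A := StarAlgebra.adjoin ℂ {c}) ?_ fun g hg => ?_
  · intro x y hxy
    exact ⟨circleCoe, ⟨circleCoe, ⟨c, StarAlgebra.self_mem_adjoin_singleton ℂ c, rfl⟩, rfl⟩,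
      fun h' => hxy (Subtype.ext h')⟩
  · have hg' : g ∈ Submodule.span ℂ
        (Submonoid.closure ({c} ∪ star {c}) : Set (BoundedContinuousFunction Circle ℂ)) := by
      rw [← Algebra.adjoin_eq_span]
      exact hg
    have hint : ∀ (ρ : Measure Circle) [IsFiniteMeasure ρ] (f : BoundedContinuousFunction Circle ℂ),
        Integrable f ρ := fun ρ _ f => f.integrable ρ
    clear hg
    induction hg' using Submodule.span_induction with
    | mem f hf =>
      have hf' : ∃ m : ℤ, ∀ z : Circle, f z = (z : ℂ) ^ m := by
        induction hf using Submonoid.closure_induction with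
        | mem f hf =>
          rcases hf with hf | hf
          · rw [Set.mem_singleton_iff] at hf
            exact ⟨1, fun z => by rw [hf, zpow_one]; rfl⟩
          · have hf' : f = star c := by
              rw [Set.star_singleton, Set.mem_singleton_iff] at hf
              exact hf
            exact ⟨-1, fun z => by
              rw [hf', zpow_neg_one, ← Circle.coe_inv, Circle.coe_inv_eq_conj]
              rfl⟩
        | one => exact ⟨0, fun z => by simp⟩
        | mul f f' _ _ h1 h2 =>
          obtain ⟨m, hm⟩ := h1
          obtain ⟨m', hm'⟩ := h2
          exact ⟨m + m', fun z => by
            rw [BoundedContinuousFunction.mul_apply, hm, hm', zpow_add₀ (Circle.coe_ne_zero z)]⟩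
      obtain ⟨m, hm⟩ := hf'
      simp only [hm, h]
    | zero => simp
    | add f f' _ _ h1 h2 =>
      simp only [BoundedContinuousFunction.coe_add, Pi.add_apply]
      rw [integral_add (hint μ f) (hint μ f'), integral_add (hint ν f) (hint ν f'), h1, h2]
    | smul r f _ h1 =>
      simp only [BoundedContinuousFunction.coe_smul, smul_eq_mul]
      rw [integral_const_mul, integral_const_mul, h1]

theorem IsAssociatedMeasure.eq_of_Tr_zpow_eq (h : IsAssociatedMeasure u μ)
    (h' : IsAssociatedMeasure v ν)
    (huv : ∀ m : ℤ, Tr ((u ^ m : unitary (UProd n ω)) : UProd n ω) =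
      Tr ((v ^ m : unitary (UProd n ω)) : UProd n ω)) : μ = ν := by
  have := h.isProbabilityMeasure
  have := h'.isProbabilityMeasure
  exact measure_ext_of_moments fun m => by rw [h.integral_zpow, h'.integral_zpow, huv]

theorem Tr_zpow_conj (w : unitary (UProd n ω))
    (hv : (v : UProd n ω) = (w : UProd n ω) * (u : UProd n ω) * star (w : UProd n ω)) (m : ℤ) :
    Tr ((u ^ m : unitary (UProd n ω)) : UProd n ω) =
      Tr ((v ^ m : unitary (UProd n ω)) : UProd n ω) := by
  have hv' : v = w * u * w⁻¹ := Subtype.ext hv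
  rw [hv', conj_zpow]
  change _ = Tr ((w : UProd n ω) * _ * star (w : UProd n ω))
  rw [Tr_mul_comm, ← mul_assoc, Unitary.star_mul_self_of_mem w.2, one_mul]

end

/-! ### Matching eigenvalues and conjugating unitaries -/

section

variable {n : ℕ → ℕ+} {ω : Ultrafilter ℕ} {u v : unitary (UProd n ω)} {μ ν : Measure Circle}

/-- Two colourings of a finite set can be matched by a permutation up to the excess of the numbers
of points of each colour. -/
theorem exists_perm_card_ne_le {ι J : Type*} [Fintype ι] [DecidableEq ι] [Fintype J]
    [DecidableEq J] (a b : ι → J) :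
    ∃ σ : Equiv.Perm ι, (Finset.univ.filter fun i => a (σ i) ≠ b i).card ≤
      ∑ j, ((Finset.univ.filter fun i => a i = j).card - (Finset.univ.filter fun i => b i = j).card) := by
  -- Take a permutation with the fewest mismatches. The subtraction in the bound is truncated, so
  -- only colours in excess contribute.
  obtain ⟨σ, hσ⟩ := Finite.exists_min fun σ : Equiv.Perm ι =>
    (Finset.univ.filter fun i => a (σ i) ≠ b i).card
  refine ⟨σ, ?_⟩
  rw [Finset.card_eq_sum_card_fiberwise (f := fun i => a (σ i)) (t := Finset.univ) (by simp)]
  refine Finset.sum_le_sum fun j _ => ?_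
  rw [Finset.filter_filter]
  rcases Finset.eq_empty_or_nonempty
    (Finset.univ.filter fun i => a (σ i) ≠ b i ∧ a (σ i) = j) with h | ⟨i, hi⟩
  · rw [h]
    simp
  · rw [Finset.mem_filter] at hi
    obtain ⟨-, hi, hij⟩ := hi
    -- If colour `j` is misplaced at `i`, every position wanting `j` already has it; otherwise a
    -- swap with `i` would lower the number of mismatches. The mismatches of colour `j` are
    -- therefore exactly its excess.
    have hb : ∀ i', b i' = j → a (σ i') = j := by
      intro i' hi'
      by_contra hne
      have hlt := hσ (Equiv.swap i i' |>.trans σ)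
      refine absurd hlt (not_le.2 (Finset.card_lt_card ⟨fun k hk => ?_, fun hsub => ?_⟩))
      · rw [Finset.mem_filter] at hk ⊢
        refine ⟨Finset.mem_univ _, ?_⟩
        by_cases h1 : k = i
        · rw [h1]
          exact hi
        · by_cases h2 : k = i'
          · rw [h2, hi']
            exact hne
          · simpa [Equiv.swap_apply_of_ne_of_ne h1 h2] using hk.2
      · have h1 := hsub (Finset.mem_filter.2 ⟨Finset.mem_univ i', by rwa [hi']⟩)
        rw [Finset.mem_filter] at h1
        simp [hij, hi'] at h1
    have hA : (Finset.univ.filter fun i => a i = j).card =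
        (Finset.univ.filter fun i => a (σ i) = j).card :=
      (Finset.card_equiv σ (by simp)).symm
    have hsplit : (Finset.univ.filter fun i => a (σ i) = j).card =
        (Finset.univ.filter fun i => a (σ i) ≠ b i ∧ a (σ i) = j).card +
        (Finset.univ.filter fun i => b i = j).card := by
      rw [← Finset.card_union_of_disjoint]
      · congr 1
        ext k
        simp only [Finset.mem_filter, Finset.mem_univ, true_and, Finset.mem_union]
        constructor
        · intro hk
          by_cases hk' : b k = j
          · exact Or.inr hk'
          · exact Or.inl ⟨fun h => hk' (h ▸ hk), hk⟩
        · rintro (hk | hk)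
          · exact hk.2
          · exact hb k hk
      · rw [Finset.disjoint_left]
        intro k hk hk'
        rw [Finset.mem_filter] at hk hk'
        exact hk.2.1 (hk.2.2.trans hk'.2.symm)
    omega

theorem measure_frontier_iInter_eq_zero {X ι : Type*} [TopologicalSpace X] [MeasurableSpace X]
    {μ : Measure X} [Finite ι] {s : ι → Set X} (h : ∀ i, μ (frontier (s i)) = 0) :
    μ (frontier (⋂ i, s i)) = 0 := by
  classical
  have := Fintype.ofFinite ι
  suffices H : ∀ t : Finset ι, μ (frontier (⋂ i ∈ t, s i)) = 0 by simpa using H Finset.univ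
  intro t
  induction t using Finset.induction_on with
  | empty => simp
  | insert i t _ ih =>
    rw [Finset.set_biInter_insert]
    refine measure_mono_null (frontier_inter_subset _ _) (measure_union_null ?_ ?_)
    · exact measure_mono_null Set.inter_subset_left (h i)
    · exact measure_mono_null Set.inter_subset_right ih

/-- A compact metric space has finite colourings with small colour classes whose boundaries are
null. -/
theorem exists_coloring {X : Type} [PseudoMetricSpace X] [CompactSpace X] [MeasurableSpace X]
    [BorelSpace X] (μ : Measure X) [IsFiniteMeasure μ] {ε : ℝ} (hε : 0 < ε) :
    ∃ (J : Type) (_ : Fintype J) (_ : DecidableEq J) (c : X → J),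
      (∀ j, μ (frontier {z | c z = j}) = 0) ∧ (∀ j, MeasurableSet {z | c z = j}) ∧
      ∀ z z', c z = c z' → dist z z' ≤ ε := by
  classical
  -- All but countably many radii give a null boundary, so one exists below `ε / 2`.
  choose r hr hμ using fun z : X => exists_null_frontier_thickening μ {z} (half_pos hε)
  simp only [Metric.thickening_singleton] at hμ
  obtain ⟨t, -, ht⟩ := isCompact_univ.elim_nhds_subcover (fun z => Metric.ball z (r z))
    fun z _ => Metric.ball_mem_nhds z (hr z).1
  have hset : ∀ j : t → Bool, {z | (fun y : t => decide (z ∈ Metric.ball y.1 (r y))) = j} =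
      ⋂ y : t, {z | decide (z ∈ Metric.ball y.1 (r y)) = j y} := fun j => by
    ext z
    simp [funext_iff]
  have hset' : ∀ (y : t) (b : Bool), {z | decide (z ∈ Metric.ball y.1 (r y)) = b} =
      if b then Metric.ball y.1 (r y) else (Metric.ball y.1 (r y))ᶜ := fun y b => by
    ext z
    cases b <;> simp
  -- The colour of a point records which balls of the finite cover contain it; points of equal
  -- colour share a ball of radius less than `ε / 2`.
  refine ⟨t → Bool, inferInstance, inferInstance, fun z y => decide (z ∈ Metric.ball y.1 (r y)),
    fun j => ?_, fun j => ?_, fun z z' h => ?_⟩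
  · rw [hset]
    refine measure_frontier_iInter_eq_zero fun y => ?_
    rw [hset']
    split_ifs
    · exact hμ y
    · rw [frontier_compl]
      exact hμ y
  · rw [hset]
    refine MeasurableSet.iInter fun y => ?_
    rw [hset']
    split_ifs
    · exact measurableSet_ball
    · exact measurableSet_ball.compl
  · obtain ⟨y, hy, hz⟩ := Set.mem_iUnion₂.1 (ht (Set.mem_univ z))
    have h1 := congrFun h ⟨y, hy⟩
    simp only [decide_eq_decide] at h1
    have h2 := Metric.mem_ball.1 hz
    have h3 := Metric.mem_ball.1 (h1.1 hz)
    linarith [dist_triangle_right z z' y, (hr y).2]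

theorem specMeasure_real_apply {m : ℕ+} (e : Fin m → Circle) {s : Set Circle} (hs : MeasurableSet s)
    [DecidablePred (· ∈ s)] : ((specMeasure e : Measure Circle) s).toReal =
      ((m : ℕ) : ℝ)⁻¹ * (Finset.univ.filter fun i => e i ∈ s).card := by
  rw [coe_specMeasure, Measure.smul_apply, Measure.finsetSum_apply]
  simp only [Measure.dirac_apply' _ hs, smul_eq_mul, ENNReal.toReal_mul, ENNReal.toReal_inv,
    ENNReal.toReal_natCast]
  congr 1
  rw [Finset.card_filter, ENNReal.toReal_sum fun i _ => by simp [Set.indicator_apply]; split_ifs <;> simp]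
  push_cast
  refine Finset.sum_congr rfl fun i _ => ?_
  by_cases h : e i ∈ s <;> simp [h]

/-- Finite families of points of the circle with the same limit distribution can be matched by
permutations up to a small mean square distance. -/
theorem eventually_exists_perm {e e' : ∀ k, Fin (n k) → Circle} {μ : ProbabilityMeasure Circle}
    (h : Tendsto (fun k => specMeasure (e k)) ω (𝓝 μ))
    (h' : Tendsto (fun k => specMeasure (e' k)) ω (𝓝 μ)) {ε : ℝ} (hε : 0 < ε) :
    ∀ᶠ k in (ω : Filter ℕ), ∃ σ : Equiv.Perm (Fin (n k)),
      ((n k : ℕ) : ℝ)⁻¹ * ∑ i, ‖(e k (σ i) : ℂ) - e' k i‖ ^ 2 ≤ ε ^ 2 + ε := by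
  classical
  obtain ⟨J, _, _, c, hc0, hcm, hcd⟩ := exists_coloring (μ : Measure Circle) hε
  -- Portmanteau: the cells have `μ`-null boundaries, so the proportions of points in them converge.
  have hlim : ∀ {e : ∀ k, Fin (n k) → Circle}, Tendsto (fun k => specMeasure (e k)) ω (𝓝 μ) →
      ∀ j, Tendsto (fun k => ((n k : ℕ) : ℝ)⁻¹ * (Finset.univ.filter fun i => c (e k i) = j).card) ω
        (𝓝 ((μ : Measure Circle) {z | c z = j}).toReal) := fun {e} he j => by
    have h1 := (ENNReal.tendsto_toReal (measure_ne_top _ _)).comp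
      (ProbabilityMeasure.tendsto_measure_of_null_frontier_of_tendsto' he (hc0 j))
    refine h1.congr fun k => ?_
    exact specMeasure_real_apply (e k) (hcm j)
  have hsum : Tendsto (fun k => ∑ j, |((n k : ℕ) : ℝ)⁻¹ * (Finset.univ.filter fun i => c (e k i) = j).card -
      ((n k : ℕ) : ℝ)⁻¹ * (Finset.univ.filter fun i => c (e' k i) = j).card|) ω (𝓝 0) := by
    have := tendsto_finsetSum Finset.univ fun j _ => ((hlim h j).sub (hlim h' j)).abs
    simpa using this
  filter_upwards [hsum.eventually_lt_const (show 0 < ε / 4 by positivity)] with k hk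
  obtain ⟨σ, hσ⟩ := exists_perm_card_ne_le (fun i => c (e k i)) (fun i => c (e' k i))
  refine ⟨σ, ?_⟩
  have hn : (0 : ℝ) < (n k : ℕ) := by exact_mod_cast (n k).pos
  set D := Finset.univ.filter fun i => c (e k (σ i)) ≠ c (e' k i)
  -- Matched points lie in a common cell; for mismatched ones the squared diameter 4 of the circle
  -- is used. This is why the excess was required to be below `ε / 4`.
  have h1 : ∀ i, ‖(e k (σ i) : ℂ) - e' k i‖ ^ 2 ≤ ε ^ 2 + if c (e k (σ i)) ≠ c (e' k i) then 4 else 0 := by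
    intro i
    split_ifs with hi
    · have : ‖(e k (σ i) : ℂ) - e' k i‖ ≤ 2 := (norm_sub_le _ _).trans_eq (by
        rw [Circle.norm_coe, Circle.norm_coe]
        norm_num)
      nlinarith [norm_nonneg ((e k (σ i) : ℂ) - e' k i), sq_nonneg ε]
    · have : ‖(e k (σ i) : ℂ) - e' k i‖ ≤ ε := by
        rw [← dist_eq_norm]
        exact hcd _ _ (not_not.1 hi)
      rw [add_zero]
      exact pow_le_pow_left₀ (norm_nonneg _) this 2
  have h2 : ∑ i, ‖(e k (σ i) : ℂ) - e' k i‖ ^ 2 ≤ (n k : ℕ) * ε ^ 2 + 4 * D.card := by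
    refine (Finset.sum_le_sum fun i _ => h1 i).trans_eq ?_
    rw [Finset.sum_add_distrib, ← Finset.sum_filter]
    simp [D, mul_comm]
  have h3 : ((n k : ℕ) : ℝ)⁻¹ * D.card ≤ ε / 4 := by
    refine le_trans ?_ hk.le
    calc ((n k : ℕ) : ℝ)⁻¹ * D.card ≤ ((n k : ℕ) : ℝ)⁻¹ * ((∑ j,
          ((Finset.univ.filter fun i => c (e k i) = j).card -
            (Finset.univ.filter fun i => c (e' k i) = j).card) : ℕ) : ℝ) := by
          gcongr
      _ ≤ _ := by
          rw [Nat.cast_sum, Finset.mul_sum]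
          refine Finset.sum_le_sum fun j _ => ?_
          rw [← mul_sub, abs_mul, abs_of_pos (inv_pos.2 hn)]
          gcongr
          rcases le_total (Finset.univ.filter fun i => c (e k i) = j).card
            (Finset.univ.filter fun i => c (e' k i) = j).card with hle | hle
          · rw [Nat.sub_eq_zero_of_le hle, Nat.cast_zero]
            exact abs_nonneg _
          · rw [Nat.cast_sub hle]
            exact le_abs_self _
  calc ((n k : ℕ) : ℝ)⁻¹ * ∑ i, ‖(e k (σ i) : ℂ) - e' k i‖ ^ 2
      ≤ ((n k : ℕ) : ℝ)⁻¹ * ((n k : ℕ) * ε ^ 2 + 4 * D.card) := by gcongr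
    _ = ε ^ 2 + 4 * (((n k : ℕ) : ℝ)⁻¹ * D.card) := by field_simp
    _ ≤ ε ^ 2 + ε := by linarith

/-- Choosing for each `k` the permutation of least cost makes the choice independent of `ε`, so one
sequence works for all precisions. -/
theorem exists_perm_tendsto {e e' : ∀ k, Fin (n k) → Circle} {μ : ProbabilityMeasure Circle}
    (h : Tendsto (fun k => specMeasure (e k)) ω (𝓝 μ))
    (h' : Tendsto (fun k => specMeasure (e' k)) ω (𝓝 μ)) :
    ∃ σ : ∀ k, Equiv.Perm (Fin (n k)), Tendsto
      (fun k => ((n k : ℕ) : ℝ)⁻¹ * ∑ i, ‖(e k (σ k i) : ℂ) - e' k i‖ ^ 2) ω (𝓝 0) := by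
  choose σ hσ using fun k => Finite.exists_min fun σ : Equiv.Perm (Fin (n k)) =>
    ((n k : ℕ) : ℝ)⁻¹ * ∑ i, ‖(e k (σ i) : ℂ) - e' k i‖ ^ 2
  refine ⟨σ, Metric.tendsto_nhds.2 fun δ hδ => ?_⟩
  -- For `ε ≤ 1` and `ε ≤ δ / 3` one has `ε² + ε ≤ 2ε < δ`.
  have hε : 0 < min 1 (δ / 3) := by positivity
  filter_upwards [eventually_exists_perm h h' hε] with k ⟨τ, hτ⟩
  rw [Real.dist_0_eq_abs, abs_of_nonneg (by positivity)]
  refine ((hσ k τ).trans hτ).trans_lt ?_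
  nlinarith [min_le_left 1 (δ / 3), min_le_right 1 (δ / 3)]

/-- Permuting the columns of `W` along with the diagonal entries leaves the matrix unchanged, so
eigenvalues may be reordered freely. -/
theorem exists_conjDiag_comp_perm {m : ℕ+} (W : unitary (Mat m)) (σ : Equiv.Perm (Fin m)) :
    ∃ V : unitary (Mat m), ∀ d, conjDiag V (d ∘ σ) = conjDiag W d := by
  have hstar : star ((W : Mat m).submatrix id σ) = (star (W : Mat m)).submatrix σ id := rfl
  have h1 : (W : Mat m).submatrix id σ * (star (W : Mat m)).submatrix σ id = 1 := by
    rw [Matrix.submatrix_mul_equiv, Unitary.mul_star_self_of_mem W.2, Matrix.submatrix_id_id]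
  refine ⟨⟨(W : Mat m).submatrix id σ, ?_, ?_⟩, fun d => ?_⟩
  · rw [hstar]
    exact mul_eq_one_comm.1 h1
  · rw [hstar]
    exact h1
  · change (W : Mat m).submatrix id σ * Matrix.diagonal (d ∘ σ) * star ((W : Mat m).submatrix id σ) = _
    rw [hstar, ← Matrix.submatrix_diagonal_equiv, Matrix.submatrix_mul_equiv,
      Matrix.submatrix_mul_equiv, Matrix.submatrix_id_id, conjDiag]

theorem conj_conjDiag {m : ℕ+} (V W : unitary (Mat m)) (d : Fin m → ℂ) :
    ((V * star W : unitary (Mat m)) : Mat m) * conjDiag W d *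
      star ((V * star W : unitary (Mat m)) : Mat m) = conjDiag V d := by
  have h := Unitary.star_mul_self_of_mem W.2
  simp only [conjDiag, Submonoid.coe_mul, Unitary.coe_star, star_mul, star_star, mul_assoc]
  rw [← mul_assoc (star (W : Mat m)) W, h, one_mul, ← mul_assoc (star (W : Mat m)) W, h, one_mul]

/-- Unitaries whose eigenvalue distributions have the same limit are conjugate. -/
theorem exists_conj_of_tendsto {W W' : ∀ k, unitary (Mat (n k))} {e e' : ∀ k, Fin (n k) → Circle}
    {μ : ProbabilityMeasure Circle} (h : Tendsto (fun k => specMeasure (e k)) ω (𝓝 μ))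
    (h' : Tendsto (fun k => specMeasure (e' k)) ω (𝓝 μ)) :
    ∃ w : unitary (UProd n ω),
      fc W' e' circleCoe = (w : UProd n ω) * fc W e circleCoe * star (w : UProd n ω) := by
  obtain ⟨σ, hσ⟩ := exists_perm_tendsto h h'
  choose V hV using fun k => exists_conjDiag_comp_perm (W k) (σ k)
  -- Conjugation by `W'_k V_k^*` puts the reordered eigenvalues `e_k ∘ σ_k` into the eigenbasis
  -- `W'_k`. The trace-norm error is then the root mean square distance of the matched eigenvalues.
  refine ⟨UProd.mkUnitary fun k => W' k * star (V k), ?_⟩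
  have hlim : Tendsto (fun k => norm2 (conjDiag (W' k) (fun i => (e' k i : ℂ)) -
      conjDiag (W' k) ((fun i => (e k i : ℂ)) ∘ σ k))) ω (𝓝 0) := by
    have h1 := (Real.continuous_sqrt.tendsto _).comp hσ
    rw [Real.sqrt_zero] at h1
    refine h1.congr fun k => ?_
    rw [← conjDiag_sub, norm2_conjDiag, Function.comp_apply]
    simp only [Pi.sub_apply, Function.comp_apply, norm_sub_rev]
  refine UProd.mk_eq_mk.2 (hlim.congr fun k => ?_)
  rw [← conj_conjDiag (W' k) (V k) ((fun i => (e k i : ℂ)) ∘ σ k), hV]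
  rfl

end

end MatrixUltraproduct

end

open MatrixUltraproduct in
theorem mainTheorem4 (n : ℕ → ℕ+) (hn : Tendsto (fun k => (n k : ℕ)) atTop atTop)
    (ω : Ultrafilter ℕ) (hω : (ω : Filter ℕ) ≤ cofinite) :
    (∀ u : unitary (UProd n ω), ∃! μ : Measure Circle, IsAssociatedMeasure u μ) ∧
    (∀ (u : unitary (UProd n ω)) (μ : Measure Circle), IsAssociatedMeasure u μ →
      ∀ m : ℤ, ∫ z : Circle, (z : ℂ) ^ m ∂μ = Tr ((u ^ m : unitary (UProd n ω)) : UProd n ω)) ∧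
    (∀ (u v : unitary (UProd n ω)) (μ ν : Measure Circle),
      IsAssociatedMeasure u μ → IsAssociatedMeasure v ν →
      ((∃ w : unitary (UProd n ω),
          (v : UProd n ω) = (w : UProd n ω) * (u : UProd n ω) * star (w : UProd n ω)) ↔
        μ = ν)) := by
  refine ⟨fun u => ?_, fun u μ h m => h.integral_zpow m, fun u v μ ν hu hv => ⟨?_, fun hμν => ?_⟩⟩
  · obtain ⟨-, -, μ, -, -, hμ⟩ := exists_isAssociatedMeasure hω u
    exact ⟨μ, hμ, fun ν hν => hν.eq_of_Tr_zpow_eq hμ fun _ => rfl⟩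
  · rintro ⟨w, hw⟩
    exact hu.eq_of_Tr_zpow_eq hv (Tr_zpow_conj w hw)
  · obtain ⟨W, e, μ₁, hWu, he, hμ₁⟩ := exists_isAssociatedMeasure hω u
    obtain ⟨W', e', μ₂, hWv, he', hμ₂⟩ := exists_isAssociatedMeasure hω v
    -- Uniqueness identifies the limits of the eigenvalue distributions with the given associated
    -- measures, hence with each other.
    have h1 : μ₁ = μ₂ := Subtype.ext <| (hμ₁.eq_of_Tr_zpow_eq hu fun _ => rfl).trans <|
      hμν.trans (hv.eq_of_Tr_zpow_eq hμ₂ fun _ => rfl)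
    rw [← hWu, ← hWv]
    exact exists_conj_of_tendsto he (h1 ▸ he')
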